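/- A *map* $\mathbb G=[\sigma,\alpha,\phi]$ consists of permutations of a finite set $D$ of darts such that $\alpha$ is a fixed-point-free involution and $\phi=\sigma^{-1}\alpha^{-1}$ (products are composed from right to left). Its vertices, edges and faces are the cycles of $\sigma,\alpha,\phi$, fixed points included; if $D=\emptyset$ there are no edges, and $\sigma$ and $\phi$ are each taken to have one (empty) cycle. The map is *connected* if, for every partition of its vertices into two non-empty classes, some edge has one dart in each class. A connected map with $v$ vertices, $e$ edges and $f$ faces is *plane* if $\tfrac12(2-v+e-f)=0$. The *underlying abstract graph* $G$ has the cycles of $\sigma$ as vertices and the cycles of $\alpha$ as edges, each edge joining the vertices that contain its two darts. In a *directed map* $\vec{\mathbb G}$ the two darts of each edge $e$ are labelled $e^+$ (head) and $e^-$ (tail); this directs the edges of $G$, giving the *underlying abstract directed graph* $\vec G$. For a set $T$ of edges let $\alpha^T$ agree with $\alpha$ on the darts of the edges in $T$ and fix all other darts. The *induced submap* $\mathbb G[T]$ is obtained by deleting from $\sigma$ and $\alpha$ all darts of edges not in $T$ (and taking the resulting $\phi$); it is a *spanning quasi-tree* if it has exactly one face and as many vertices as $\mathbb G$. For the edge set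 $T$ of a spanning quasi-tree, $A(\vec{\mathbb G},T)$ is the integer matrix indexed by the edges whose $(e,f)$ entry is $1$ if removing from $\alpha^T\sigma$ all darts except $e^\pm,f^\pm$ leaves $(e^+\,f^+\,e^-\,f^-)$, is $-1$ if it leaves $(f^+\,e^+\,f^-\,e^-)$, and is $0$ otherwise. For a directed connected abstract graph $\vec H$ with edge set $E$ and the edge set $T$ of a spanning tree, the *signed cycle–cocycle matrix* $M(\vec H,T)$ is the $E\times E$ integer matrix whose rows are as follows. For $e\notin T$, row $e$ is supported on the unique cycle with all its edges in $T\cup\{e\}$; walking around it in the direction of $e$, an edge has sign $+1$ if traversed from tail to head and $-1$ otherwise. For $e\in T$, row $e$ is supported on the unique cocycle $C^*$ (minimal set of edges whose removal disconnects the graph) containing no edge of $T$ except $e$; an edge of $C^*$ has sign $+1$ if its head lies in the same component of $\vec H\setminus C^*$ as the head of $e$, and $-1$ if its head lies in the same component as the tail of $e$. The *cokernel* of an $m\times m$ integer matrix is the quotient of $\mathbb Z^m$ by the span of its rows. The *critical group* $K(\mathbb G)$ of a connected map is the cokernel of $A(\vec{\mathbb G},T)+I$ for any directing $\vec{\mathbb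 G}$ of $\mathbb G$ and any edge set $T$ of a spanning quasi-tree; the *classical critical group* $K(G)$ of a connected abstract graph is the cokernel of $M(\vec G,T')$ for any directing $\vec G$ of its edges and any edge set $T'$ of a spanning tree. **Theorem.** Let $\vec{\mathbb G}$ be a directed connected plane map with underlying map $\mathbb G$, underlying abstract directed graph $\vec G$ and underlying abstract graph $G$. 1. If $T$ is the edge set of a spanning tree of $\vec G$, then $T$ is the edge set of a spanning quasi-tree of $\mathbb G$ and $$M(\vec G,T)=A(\vec{\mathbb G},T)+I .$$ 2. Consequently $K(\mathbb G)\cong K(G)$. Explicitly, $G$ has a spanning tree, and for every edge set $T$ of a spanning quasi-tree of $\mathbb G$, every directing $\vec G'$ of the edges of $G$, and every edge set $T'$ of a spanning tree of $G$, $$\mathbb Z^{E}/\langle A(\vec{\mathbb G},T)+I\rangle\;\cong\;\mathbb Z^{E}/\langle M(\vec G',T')\rangle ,$$ where $E$ is the common edge set of $\mathbb G$ and $G$. -/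

import Mathlib

noncomputable section

namespace MapCritical

open scoped Graph

/-! ### Cycles of a permutation, and deletion of entries from a permutation -/

/-- The cycles of a permutation, fixed points included. The permutation of the empty set is
stipulated to have exactly one (empty) cycle. -/
def Cycles {D : Type*} (β : Equiv.Perm D) : Type _ :=
  Quotient (Equiv.Perm.SameCycle.setoid β) ⊕ PLift (IsEmpty D)

/-- The cycle containing a given element. -/
def cycleOf {D : Type*} (β : Equiv.Perm D) (d : D) : Cycles β :=
  Sum.inl (Quotient.mk (Equiv.Perm.SameCycle.setoid β) d)

/-- The number of cycles (one for the permutation of the empty set). -/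
def numCycles {D : Type*} (β : Equiv.Perm D) : ℕ := Nat.card (Cycles β)

/-- A permutation is cyclic if it has only one cycle. -/
def IsCyclic {D : Type*} (β : Equiv.Perm D) : Prop := numCycles β = 1

theorem exists_return {D : Type*} [Finite D] (β : Equiv.Perm D) (S : Set D) (d : S) :
    ∃ n : ℕ, 0 < n ∧ (β ^ n) (d : D) ∈ S := by
  obtain ⟨n, hn, h⟩ := (isOfFinOrder_of_finite β).exists_pow_eq_one
  exact ⟨n, hn, by rw [h]; exact d.2⟩

open Classical in
/-- The first element of `S` met after `d` when following the cycle of `β` through `d ∈ S`. -/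
def nextIn {D : Type*} [Finite D] (β : Equiv.Perm D) (S : Set D) (d : S) : S :=
  ⟨(β ^ Nat.find (exists_return β S d)) (d : D), (Nat.find_spec (exists_return β S d)).2⟩

theorem nextIn_injective {D : Type*} [Finite D] (β : Equiv.Perm D) (S : Set D) :
    Function.Injective (nextIn β S) := by
  classical
  have key : ∀ a b : S, Nat.find (exists_return β S a) ≤ Nat.find (exists_return β S b) →
      nextIn β S a = nextIn β S b → a = b := by
    intro a b hle hab
    have h1 : (β ^ Nat.find (exists_return β S a)) (a : D) =
        (β ^ Nat.find (exists_return β S b)) (b : D) := congrArg Subtype.val hab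
    obtain ⟨k, hk⟩ := Nat.exists_eq_add_of_le hle
    rw [hk, pow_add, Equiv.Perm.mul_apply] at h1
    have h2 : (a : D) = (β ^ k) (b : D) := (β ^ _).injective h1
    rcases Nat.eq_zero_or_pos k with h0 | hpos
    · subst h0
      exact Subtype.ext (by simpa using h2)
    · exfalso
      have hlt : k < Nat.find (exists_return β S b) := by
        have := (Nat.find_spec (exists_return β S a)).1
        omega
      exact Nat.find_min (exists_return β S b) hlt ⟨hpos, h2 ▸ a.2⟩
  intro a b hab
  rcases le_total (Nat.find (exists_return β S a)) (Nat.find (exists_return β S b)) with h | h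
  · exact key a b h hab
  · exact (key b a h hab.symm).symm

/-- The permutation of `S` obtained from (the cycle notation of) `β` by removing all the
entries outside `S`. -/
def keep {D : Type*} [Finite D] (β : Equiv.Perm D) (S : Set D) : Equiv.Perm S :=
  Equiv.ofBijective (nextIn β S) (Finite.injective_iff_bijective.mp (nextIn_injective β S))

/-- Removing from `β` all the entries except `a, b, c, d` results in the permutation
`(a b c d)`. -/
def KeepsTo {D : Type*} [Finite D] (β : Equiv.Perm D) (a b c d : D) : Prop :=
  ((keep β {a, b, c, d} ⟨a, by simp⟩ : ({a, b, c, d} : Set D)) : D) = b ∧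
  ((keep β {a, b, c, d} ⟨b, by simp⟩ : ({a, b, c, d} : Set D)) : D) = c ∧
  ((keep β {a, b, c, d} ⟨c, by simp⟩ : ({a, b, c, d} : Set D)) : D) = d ∧
  ((keep β {a, b, c, d} ⟨d, by simp⟩ : ({a, b, c, d} : Set D)) : D) = a

/-! ### Abstract graphs -/

/-- A graph is connected if it has a vertex and any two of its vertices are joined by a walk. -/
def GraphConnected {V E : Type*} (G : Graph V E) : Prop :=
  V(G).Nonempty ∧ ∀ u ∈ V(G), ∀ v ∈ V(G), Relation.ReflTransGen G.Adj u v

/-- The vertices `u` and `v` lie in the same component of `G`. -/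
def SameComponent {V E : Type*} (G : Graph V E) (u v : V) : Prop :=
  u ∈ V(G) ∧ v ∈ V(G) ∧ Relation.ReflTransGen G.Adj u v

/-- A walk around a cycle of `G`. A step `(u, e, v)` of the walk goes from the vertex `u`
along the edge `e` to the vertex `v`; no vertex and no edge is repeated. Loops and pairs of
parallel edges form cycles of length one and two. -/
structure IsCycleWalk {V E : Type*} (G : Graph V E) (w : List (V × E × V)) : Prop where
  ne_nil : w ≠ []
  link : ∀ s ∈ w, G.IsLink s.2.1 s.1 s.2.2
  chain : w.IsChain (fun s t => s.2.2 = t.1)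
  closed : (w.getLast ne_nil).2.2 = (w.head ne_nil).1
  nodup_vertices : (w.map fun s => s.1).Nodup
  nodup_edges : (w.map fun s => s.2.1).Nodup

/-- `T` is the edge set of a spanning tree of `G`. -/
structure IsSpanningTree {V E : Type*} (G : Graph V E) (T : Set E) : Prop where
  subset : T ⊆ E(G)
  connected : GraphConnected (G.restrict T)
  acyclic : ∀ w, ¬ IsCycleWalk (G.restrict T) w

/-- A cocycle: a minimal set of edges whose removal disconnects `G`. -/
def IsCocycle {V E : Type*} (G : Graph V E) (C : Set E) : Prop :=
  Minimal (fun F : Set E => F ⊆ E(G) ∧ ¬ GraphConnected (G.deleteEdges F)) C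

/-- An abstract directed graph with vertex set (all of) `V` and edge set (all of) `E`. -/
structure DirGraph (V E : Type*) where
  /-- The tail of an edge. -/
  tail : E → V
  /-- The head of an edge. -/
  head : E → V

/-- The graph obtained by forgetting the directions of the edges. -/
def DirGraph.toGraph {V E : Type*} (H : DirGraph V E) : Graph V E where
  vertexSet := Set.univ
  edgeSet := Set.univ
  IsLink e x y := (x = H.tail e ∧ y = H.head e) ∨ (x = H.head e ∧ y = H.tail e)
  isLink_symm e _ := ⟨fun x y h => by tauto⟩
  eq_or_eq_of_isLink_of_isLink e x y v w h h' := by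
    rcases h with ⟨h1, h2⟩ | ⟨h1, h2⟩ <;> rcases h' with ⟨h3, h4⟩ | ⟨h3, h4⟩ <;> simp_all
  edge_mem_iff_exists_isLink e := ⟨fun _ => ⟨_, _, Or.inl ⟨rfl, rfl⟩⟩, fun _ => Set.mem_univ _⟩
  left_mem_of_isLink _ _ _ _ := Set.mem_univ _

open Classical in
/-- The signed incidence vector of the fundamental cycle `C(T,e)`, the unique cycle with all its
edges in `T ∪ {e}`. The cycle is walked around in the direction of `e`, and an edge of it has
sign `1` if the walk passes it from its tail to its head, and `-1` if in the other direction. -/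
def DirGraph.cycleVector {V E : Type*} (H : DirGraph V E) (T : Set E) (e : E) : E → ℤ := fun i =>
  if ∃ w, IsCycleWalk (H.toGraph.restrict (T ∪ {e})) w ∧
      (H.tail e, e, H.head e) ∈ w ∧ (H.tail i, i, H.head i) ∈ w then 1
  else if ∃ w, IsCycleWalk (H.toGraph.restrict (T ∪ {e})) w ∧
      (H.tail e, e, H.head e) ∈ w ∧ (H.head i, i, H.tail i) ∈ w then -1
  else 0

open Classical in
/-- The signed incidence vector of the fundamental cocycle `C*(T,e)`, the unique cocycle
containing `e` and no other edge of `T`. An edge of it has sign `1` if its head lies in the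
component of `G \ C*(T,e)` of the head of `e`, and `-1` if its head lies in that of the tail
of `e`. -/
def DirGraph.cocycleVector {V E : Type*} (H : DirGraph V E) (T : Set E) (e : E) : E → ℤ := fun i =>
  if ∃ C, IsCocycle H.toGraph C ∧ C ∩ T = {e} ∧ i ∈ C ∧
      SameComponent (H.toGraph.deleteEdges C) (H.head i) (H.head e) then 1
  else if ∃ C, IsCocycle H.toGraph C ∧ C ∩ T = {e} ∧ i ∈ C ∧
      SameComponent (H.toGraph.deleteEdges C) (H.head i) (H.tail e) then -1
  else 0

open Classical in
/-- The signed cycle--cocycle matrix with respect to (the edge set of) a spanning tree `T`. -/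
def DirGraph.cycleCocycleMatrix {V E : Type*} (H : DirGraph V E) (T : Set E) : Matrix E E ℤ :=
  Matrix.of fun e => if e ∈ T then H.cocycleVector T e else H.cycleVector T e

/-- The cokernel of a square integer matrix: the quotient of `ℤ^E` by the span of the rows. -/
abbrev Coker {E : Type*} (A : Matrix E E ℤ) : Type _ :=
  (E → ℤ) ⧸ Submodule.span ℤ (Set.range A.row)

/-! ### Maps -/

/-- A (combinatorial) map `[σ, α, φ]` on the set `D` of darts. -/
structure CombMap (D : Type*) where
  σ : Equiv.Perm D
  α : Equiv.Perm D
  φ : Equiv.Perm D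
  α_invol : ∀ d, α (α d) = d
  α_fixedPointFree : ∀ d, α d ≠ d
  φ_eq : φ = σ⁻¹ * α⁻¹

namespace CombMap

variable {D : Type*}

/-- Vertices are the cycles of `σ`. -/
abbrev Vertex (G : CombMap D) : Type _ := Cycles G.σ

/-- Faces are the cycles of `φ`. -/
abbrev Face (G : CombMap D) : Type _ := Cycles G.φ

/-- Edges are the cycles of `α` (there is none if there are no darts). -/
def Edge (G : CombMap D) : Type _ := Quotient (Equiv.Perm.SameCycle.setoid G.α)

instance (G : CombMap D) : DecidableEq G.Edge := Classical.decEq _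

/-- The vertex whose cycle contains the dart `d`. -/
def vertexOf (G : CombMap D) (d : D) : G.Vertex := cycleOf G.σ d

/-- The edge whose cycle contains the dart `d`. -/
def edgeOf (G : CombMap D) (d : D) : G.Edge :=
  Quotient.mk (Equiv.Perm.SameCycle.setoid G.α) d

theorem edgeOf_α (G : CombMap D) (d : D) : G.edgeOf (G.α d) = G.edgeOf d :=
  Quotient.sound (s := Equiv.Perm.SameCycle.setoid G.α) ⟨1, by simp [G.α_invol]⟩

theorem edgeOf_eq_iff (G : CombMap D) (d d' : D) :
    G.edgeOf d = G.edgeOf d' ↔ d' = d ∨ d' = G.α d := by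
  constructor
  · intro h
    obtain ⟨i, hi⟩ := Quotient.exact (s := Equiv.Perm.SameCycle.setoid G.α) h
    have h2 : G.α ^ (2 : ℤ) = 1 := by
      ext x
      simp [zpow_ofNat, pow_two, G.α_invol]
    rcases Int.even_or_odd' i with ⟨k, rfl | rfl⟩
    · left
      rw [zpow_mul, h2] at hi
      simpa using hi.symm
    · right
      rw [zpow_add, zpow_mul, h2] at hi
      simpa using hi.symm
  · rintro (rfl | rfl)
    · rfl
    · exact (G.edgeOf_α d).symm

/-- However the vertices are partitioned into two non-empty collections, some edge has one dart
in each of them. -/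
def IsConnected (G : CombMap D) : Prop :=
  ∀ C₁ C₂ : Set G.Vertex, C₁.Nonempty → C₂.Nonempty → Disjoint C₁ C₂ → C₁ ∪ C₂ = Set.univ →
    ∃ d : D, G.vertexOf d ∈ C₁ ∧ G.vertexOf (G.α d) ∈ C₂

/-- The genus of a connected map. -/
def genus (G : CombMap D) : ℚ :=
  (2 - (numCycles G.σ : ℚ) + (Nat.card G.Edge : ℚ) - (numCycles G.φ : ℚ)) / 2

/-- A plane map is a connected map of genus zero. -/
def IsPlane (G : CombMap D) : Prop := G.IsConnected ∧ G.genus = 0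

/-- A quasi-tree is a map with only one face. -/
def IsQuasiTree (G : CombMap D) : Prop := IsCyclic G.φ

/-- The submap `G[A]` induced by a set `A` of edges: the darts of the other edges are deleted
from `σ` and `α`. (As the darts of `A` are closed under `α`, the latter is just restricted.) -/
def inducedSubmap [Finite D] (G : CombMap D) (A : Set G.Edge) :
    CombMap {d : D | G.edgeOf d ∈ A} where
  σ := keep G.σ {d : D | G.edgeOf d ∈ A}
  α := G.α.subtypePerm fun d => by simp [G.edgeOf_α]
  φ := (keep G.σ {d : D | G.edgeOf d ∈ A})⁻¹ *
    (G.α.subtypePerm fun d => by simp [G.edgeOf_α])⁻¹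
  α_invol d := Subtype.ext (G.α_invol d)
  α_fixedPointFree d h := G.α_fixedPointFree d (congrArg Subtype.val h)
  φ_eq := rfl

/-- `T` is the edge set of a spanning quasi-tree. -/
def IsSpanningQuasiTree [Finite D] (G : CombMap D) (T : Set G.Edge) : Prop :=
  (G.inducedSubmap T).IsQuasiTree ∧ numCycles (G.inducedSubmap T).σ = numCycles G.σ

open Classical in
/-- The permutation `α^A`, agreeing with `α` on the darts of the edges in `A` and fixing all the
other darts. -/
def αOn (G : CombMap D) (A : Set G.Edge) : Equiv.Perm D :=
  Function.Involutive.toPerm (fun d => if G.edgeOf d ∈ A then G.α d else d) (by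
    intro d
    by_cases h : G.edgeOf d ∈ A <;> simp [h, G.edgeOf_α, G.α_invol])

/-- The underlying abstract graph: its vertices are the cycles of `σ`, its edges are the cycles
of `α`, and the ends of an edge are the vertices containing its two darts. -/
def graph (G : CombMap D) : Graph G.Vertex G.Edge where
  vertexSet := Set.univ
  edgeSet := Set.univ
  IsLink e x y := ∃ d, G.edgeOf d = e ∧ G.vertexOf d = x ∧ G.vertexOf (G.α d) = y
  isLink_symm e _ := ⟨by
    rintro x y ⟨d, rfl, rfl, rfl⟩
    exact ⟨G.α d, G.edgeOf_α d, rfl, by rw [G.α_invol]⟩⟩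
  eq_or_eq_of_isLink_of_isLink := by
    rintro e x y v w ⟨d, rfl, rfl, rfl⟩ ⟨d', h, rfl, rfl⟩
    rcases (G.edgeOf_eq_iff d d').mp h.symm with rfl | rfl
    · exact Or.inl rfl
    · exact Or.inr (by rw [G.α_invol])
  edge_mem_iff_exists_isLink e := by
    refine ⟨fun _ => ?_, fun _ => Set.mem_univ _⟩
    obtain ⟨d, rfl⟩ := Quotient.exists_rep e
    exact ⟨_, _, d, rfl, rfl, rfl⟩
  left_mem_of_isLink _ _ _ _ := Set.mem_univ _

end CombMap

/-- A directed map: in each cycle of `α` one dart is assigned to be the head. -/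
structure DirectedMap (D : Type*) extends CombMap D where
  /-- The dart `e⁺`, the head of the edge `e`. -/
  pos : toCombMap.Edge → D
  edgeOf_pos : ∀ e, toCombMap.edgeOf (pos e) = e

namespace DirectedMap

variable {D : Type*}

/-- The dart `e⁻`, the tail of the edge `e`. -/
def neg (G : DirectedMap D) (e : G.Edge) : D := G.α (G.pos e)

/-- The underlying abstract directed graph. -/
def dirGraph (G : DirectedMap D) : DirGraph G.Vertex G.Edge where
  tail e := G.vertexOf (G.neg e)
  head e := G.vertexOf (G.pos e)

theorem toGraph_dirGraph (G : DirectedMap D) : G.dirGraph.toGraph = G.graph := by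
  refine Graph.ext rfl fun e x y => ?_
  constructor
  · rintro (⟨rfl, rfl⟩ | ⟨rfl, rfl⟩)
    · exact ⟨G.neg e, (G.edgeOf_α _).trans (G.edgeOf_pos e), rfl, by
        simp [neg, G.α_invol, dirGraph]⟩
    · exact ⟨G.pos e, G.edgeOf_pos e, rfl, rfl⟩
  · rintro ⟨d, rfl, rfl, rfl⟩
    rcases (G.edgeOf_eq_iff _ _).mp (G.edgeOf_pos (G.edgeOf d)) with h | h
    · exact Or.inr ⟨congrArg _ h, congrArg (fun x => G.vertexOf (G.α x)) h⟩
    · have h' : G.pos (G.edgeOf d) = G.α d := by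
        conv_rhs => rw [h, G.α_invol]
      exact Or.inl ⟨congrArg _ h, congrArg _ h'.symm⟩

open Classical in
/-- The matrix `A(G,T)` of a directed map and the edge set `T` of a spanning quasi-tree. -/
def matrixA [Finite D] (G : DirectedMap D) (T : Set G.Edge) : Matrix G.Edge G.Edge ℤ :=
  Matrix.of fun e f =>
    if KeepsTo (G.αOn T * G.σ) (G.pos e) (G.pos f) (G.neg e) (G.neg f) then 1
    else if KeepsTo (G.αOn T * G.σ) (G.pos f) (G.pos e) (G.neg f) (G.neg e) then -1
    else 0

end DirectedMap

end MapCritical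

end

/-!
Everything is read off from the permutation `τ = α^T σ`. For any map, `T` is the edge set of a
spanning quasi-tree if and only if `τ` is cyclic (`isSpanningQuasiTree_iff`), and `τ` is cyclic if
`T` is a spanning tree, as the edges of a tree successively merge the cycles of `σ`
(`isCyclic_of_isSpanningTree`).

Let `τ` be cyclic. Then `σ = α^T τ` and `φ⁻¹ = α^{Tᶜ} τ`. Multiplying by a transposition creates at
most one new cycle, so that `v ≤ |T| + 1` and `f ≤ |Tᶜ| + 1`; for a plane map `v + f = e + 2`, and
both are equalities (`IsPlane.ncard_add_one_le`). A pair of crossing chords of the cycle `τ` would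
split it and then merge the two parts, so equality says that the edges of `T` do not cross as chords
of `τ`, nor do those outside `T` (`α_mem_arc_of_le_numCycles`). Consequently, for an edge `f` of `T`
the arc of `τ` from `f⁺` to `f⁻` is a union of cycles of `σ` that no other edge of `T` leaves: it is
the side of the head of `f` in the cut that `f` defines (`isSide_sideOf`). This shows that `T` is a
spanning tree (`isSpanningTree_of_isCyclic`). It also gives the entries of `M`: those of the
fundamental cocycle of `f` and, up to sign, those in column `f` of the fundamental cycles are the
increments of the indicator function of this side (`IsSide.cocycleVector_eq`,
`IsSide.cycleVector_eq`), and the interlacement recorded by `A` is expressed by the same arc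
(`matrixA_apply`), whence `M = A + I` (`cycleCocycleMatrix_eq`).

For the cokernels, the rows of `M` for any spanning tree span the sum of the lattices of integer
flows and integer cuts of the graph (`span_range_row_cycleCocycleMatrix`), and redirecting edges
only changes signs of coordinates (`nonempty_coker_equiv`).
-/

noncomputable section

namespace MapCritical

open scoped Graph

open Equiv.Perm

/-! ### Cycles of a permutation and multiplication by transpositions -/

section Perm

variable {D : Type*}

theorem mem_of_sameCycle [Finite D] {β : Equiv.Perm D} {S : Set D} (h : ∀ d ∈ S, β d ∈ S)
    {x y : D} (hxy : β.SameCycle x y) (hx : x ∈ S) : y ∈ S := by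
  obtain ⟨n, rfl⟩ := hxy.exists_nat_pow_eq
  induction n with
  | zero => simpa using hx
  | succ n ih => rw [pow_succ']; exact h _ (ih ⟨n, by simp⟩)

theorem SameCycle.mono [Finite D] {β γ : Equiv.Perm D} (h : ∀ d, γ.SameCycle d (β d)) {x y : D}
    (hxy : β.SameCycle x y) : γ.SameCycle x y :=
  mem_of_sameCycle (S := {d | γ.SameCycle x d}) (fun d hd => SameCycle.trans hd (h d)) hxy
    (SameCycle.refl γ x)

theorem numCycles_eq_card [Nonempty D] (β : Equiv.Perm D) :
    numCycles β = Nat.card (Quotient (SameCycle.setoid β)) := by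
  have : IsEmpty (PLift (IsEmpty D)) := ⟨fun h => h.down.false (Classical.arbitrary D)⟩
  exact Nat.card_congr (Equiv.sumEmpty _ _)

theorem numCycles_of_isEmpty [IsEmpty D] (β : Equiv.Perm D) : numCycles β = 1 := by
  have : IsEmpty (Quotient (SameCycle.setoid β)) := ⟨fun q => isEmptyElim q.out⟩
  rw [numCycles, Cycles, Nat.card_congr (Equiv.emptySum _ _), Nat.card_eq_one_iff_unique]
  exact ⟨inferInstance, ⟨⟨inferInstance⟩⟩⟩

theorem isCyclic_iff (β : Equiv.Perm D) : IsCyclic β ↔ ∀ x y, β.SameCycle x y := by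
  rcases isEmpty_or_nonempty D with hD | hD
  · exact ⟨fun _ x => isEmptyElim x, fun _ => numCycles_of_isEmpty β⟩
  · rw [IsCyclic, numCycles_eq_card, Nat.card_eq_one_iff_unique]
    constructor
    · rintro ⟨h, -⟩ x y
      exact Quotient.exact (s := SameCycle.setoid β) (Subsingleton.elim _ _)
    · intro h
      refine ⟨⟨fun p q => ?_⟩, ⟨Quotient.mk _ hD.some⟩⟩
      induction p, q using Quotient.inductionOn₂ with
      | h x y => exact Quotient.sound (h x y)

theorem numCycles_inv (β : Equiv.Perm D) : numCycles β⁻¹ = numCycles β := by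
  have : SameCycle.setoid β⁻¹ = SameCycle.setoid β := by
    ext x y; exact sameCycle_inv
  rw [numCycles, numCycles, Cycles, Cycles, this]

open Classical in
theorem sameCycle_swap_mul_apply {β : Equiv.Perm D} {x y : D}
    (h : (Equiv.swap x y * β).SameCycle x y) (d : D) :
    (Equiv.swap x y * β).SameCycle d (β d) := by
  have h1 : (Equiv.swap x y * β).SameCycle d ((Equiv.swap x y * β) d) :=
    sameCycle_apply_right.2 (SameCycle.refl _ _)
  rcases eq_or_ne (β d) x with hx | hx
  · rw [hx]
    exact (by simpa [hx] using h1 : (Equiv.swap x y * β).SameCycle d y).trans h.symm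
  · rcases eq_or_ne (β d) y with hy | hy
    · rw [hy]
      exact (by simpa [hy] using h1 : (Equiv.swap x y * β).SameCycle d x).trans h
    · simpa [Equiv.swap_apply_of_ne_of_ne hx hy] using h1

open Classical in
/-- Multiplication by a transposition of elements of different cycles merges the two cycles: the
walk from `y` along the new permutation follows the old cycle of `y` until it is about to return
to `y`, and is then sent to `x`. -/
theorem sameCycle_swap_mul [Finite D] {β : Equiv.Perm D} {x y : D} (h : ¬ β.SameCycle x y) :
    (Equiv.swap x y * β).SameCycle x y := by
  -- the product and `β` agree on the cycle of `y` under `β`, except at the preimage of `y`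
  have key : ∀ k : ℕ, (Equiv.swap x y * β).SameCycle y ((β ^ k) y) := by
    intro k
    induction k with
    | zero => exact SameCycle.refl _ _
    | succ k ih =>
      rw [pow_succ', mul_apply]
      have h1 : (Equiv.swap x y * β).SameCycle y ((Equiv.swap x y * β) ((β ^ k) y)) :=
        sameCycle_apply_right.2 ih
      rcases eq_or_ne (β ((β ^ k) y)) x with hx | hx
      · exact absurd ⟨(k + 1 : ℕ), by rw [zpow_natCast, pow_succ', mul_apply, hx]⟩
          fun h' => h (SameCycle.symm h')
      · rcases eq_or_ne (β ((β ^ k) y)) y with hy | hy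
        · rw [hy]
        · simpa [Equiv.swap_apply_of_ne_of_ne hx hy] using h1
  obtain ⟨n, hn0, hn1⟩ := (isOfFinOrder_of_finite β).exists_pow_eq_one
  obtain ⟨k, rfl⟩ := Nat.exists_eq_succ_of_ne_zero hn0.ne'
  have h1 : (Equiv.swap x y * β).SameCycle y ((Equiv.swap x y * β) ((β ^ k) y)) :=
    sameCycle_apply_right.2 (key k)
  have h2 : β ((β ^ k) y) = y := by
    rw [← mul_apply, ← pow_succ', Nat.succ_eq_add_one] at *
    rw [hn1]; rfl
  rw [mul_apply, h2, Equiv.swap_apply_right] at h1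
  exact h1.symm

open Classical in
theorem numCycles_swap_mul_add_one_le [Finite D] {β : Equiv.Perm D} {x y : D}
    (h : ¬ β.SameCycle x y) : numCycles (Equiv.swap x y * β) + 1 ≤ numCycles β := by
  have : Nonempty D := ⟨x⟩
  rw [numCycles_eq_card, numCycles_eq_card, Nat.add_one_le_iff]
  have h' := sameCycle_swap_mul h
  let F : Quotient (SameCycle.setoid β) → Quotient (SameCycle.setoid (Equiv.swap x y * β)) :=
    Quotient.map' id fun a b hab => SameCycle.mono (sameCycle_swap_mul_apply h') hab
  have hF : Function.Surjective F := fun q => by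
    induction q using Quotient.inductionOn with
    | h x => exact ⟨Quotient.mk _ x, rfl⟩
  refine lt_of_le_of_ne (Nat.card_le_card_of_surjective F hF) fun hc => ?_
  have hb : Function.Bijective F := (Nat.bijective_iff_surjective_and_card F).2 ⟨hF, hc.symm⟩
  have : F (Quotient.mk _ x) = F (Quotient.mk _ y) := Quotient.sound h'
  exact h (Quotient.exact (s := SameCycle.setoid β) (hb.1 this))

open Classical in
/-- Multiplication by a transposition merges at most one pair of cycles. -/
theorem numCycles_le_swap_mul_add_one [Finite D] (β : Equiv.Perm D) (x y : D) :
    numCycles β ≤ numCycles (Equiv.swap x y * β) + 1 := by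
  have : Nonempty D := ⟨x⟩
  rw [numCycles_eq_card, numCycles_eq_card, ← Finite.card_option]
  -- away from the cycle of `x`, distinct cycles of `β` lie in distinct cycles of the product
  have key : ∀ d d', ¬ β.SameCycle d x → ¬ β.SameCycle d' x →
      (Equiv.swap x y * β).SameCycle d d' → β.SameCycle d d' := by
    intro d d' hd hd' hdd
    by_cases hy : β.SameCycle d y
    · have hinv : ∀ z ∈ {z | β.SameCycle z x ∨ β.SameCycle z y},
          (Equiv.swap x y * β) z ∈ {z | β.SameCycle z x ∨ β.SameCycle z y} := by
        intro z hz
        rw [mul_apply]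
        rw [Equiv.swap_apply_def]
        split_ifs
        · exact Or.inr (SameCycle.refl _ _)
        · exact Or.inl (SameCycle.refl _ _)
        · simpa using hz
      rcases mem_of_sameCycle hinv hdd (Or.inr hy) with h1 | h1
      · exact absurd h1 hd'
      · exact hy.trans h1.symm
    · refine mem_of_sameCycle (S := {z | β.SameCycle d z}) (fun z hz => ?_) hdd
        (SameCycle.refl _ _)
      have hz' : β.SameCycle d (β z) := sameCycle_apply_right.2 hz
      rw [mul_apply, Equiv.swap_apply_of_ne_of_ne]
      · exact hz'
      · rintro h1; exact hd (h1 ▸ hz')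
      · rintro h1; exact hy (h1 ▸ hz')
  refine Nat.card_le_card_of_injective
    (fun q : Quotient (SameCycle.setoid β) =>
      if β.SameCycle q.out x then none
      else some (Quotient.mk (SameCycle.setoid (Equiv.swap x y * β)) q.out)) ?_
  intro q q' hqq
  suffices β.SameCycle q.out q'.out by
    rw [← q.out_eq, ← q'.out_eq]
    exact Quotient.sound this
  by_cases h1 : β.SameCycle q.out x <;> by_cases h2 : β.SameCycle q'.out x <;>
    simp only [h1, h2, if_true, if_false, reduceCtorEq, Option.some.injEq] at hqq
  · exact h1.trans h2.symm
  · exact key _ _ h1 h2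
      (Quotient.exact (s := SameCycle.setoid (Equiv.swap x y * β)) hqq)

open Classical in
theorem numCycles_swap_mul_le [Finite D] (β : Equiv.Perm D) (x y : D) :
    numCycles (Equiv.swap x y * β) ≤ numCycles β + 1 := by
  simpa [← mul_assoc] using numCycles_le_swap_mul_add_one (Equiv.swap x y * β) x y

end Perm

/-! ### Arcs of a cyclic permutation -/

section CyclicOrder

variable {D : Type*}

/-- The elements met by `τ` on its way from `x` (included) to `y` (excluded). -/
def arc (τ : Equiv.Perm D) (x y : D) : Set D :=
  {d | ∃ k : ℕ, (τ ^ k) x = d ∧ ∀ j ≤ k, (τ ^ j) x ≠ y}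

theorem left_mem_arc {τ : Equiv.Perm D} {x y : D} (h : x ≠ y) : x ∈ arc τ x y :=
  ⟨0, rfl, fun j hj => by simpa [Nat.le_zero.1 hj] using h⟩

theorem right_notMem_arc {τ : Equiv.Perm D} {x y : D} : y ∉ arc τ x y :=
  fun ⟨k, hk, h⟩ => h k le_rfl hk

open Classical in
/-- The product of a permutation with the transposition of two elements of one of its cycles maps
each of the two arcs between them into itself. -/
theorem swap_mul_apply_mem_arc [Finite D] {τ : Equiv.Perm D} {x y : D} (hxy : τ.SameCycle x y)
    (hne : x ≠ y) {d : D} (hd : d ∈ arc τ x y) : (Equiv.swap x y * τ) d ∈ arc τ x y := by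
  obtain ⟨k, rfl, hk⟩ := hd
  rw [mul_apply, ← mul_apply τ, ← pow_succ']
  rcases eq_or_ne ((τ ^ (k + 1)) x) y with hy | hy
  · rw [hy, Equiv.swap_apply_right]
    exact left_mem_arc hne
  · rw [Equiv.swap_apply_of_ne_of_ne _ hy]
    · refine ⟨k + 1, rfl, fun j hj => ?_⟩
      rcases Nat.le_succ_iff.1 hj with h | rfl
      · exact hk j h
      · exact hy
    · -- a return to `x` before meeting `y` would put `y` on another cycle
      intro hx
      obtain ⟨m, hm⟩ := hxy.exists_nat_pow_eq
      refine hk (m % (k + 1)) (Nat.le_of_lt_succ (Nat.mod_lt _ k.succ_pos)) ?_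
      rw [← hm, ← iterate_eq_pow, ← iterate_eq_pow]
      refine Function.IsPeriodicPt.iterate_mod_apply ?_ m
      rwa [Function.IsPeriodicPt, Function.IsFixedPt, iterate_eq_pow]

theorem keep_eq_of_forall_notMem [Finite D] {β : Equiv.Perm D} {S : Set D} {d : S} {k : ℕ}
    (hk : 0 < k) (hS : (β ^ k) (d : D) ∈ S) (h : ∀ j, 0 < j → j < k → (β ^ j) (d : D) ∉ S) :
    (keep β S d : D) = (β ^ k) (d : D) := by
  classical
  simp only [keep, Equiv.ofBijective_apply, nextIn]
  congr 2
  exact (Nat.find_eq_iff _).2 ⟨⟨hk, hS⟩, fun j hj hj' => h j hj'.1 hj hj'.2⟩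

theorem exists_keep_eq [Finite D] (β : Equiv.Perm D) (S : Set D) (d : S) :
    ∃ k, 0 < k ∧ (keep β S d : D) = (β ^ k) (d : D) ∧
      ∀ j, 0 < j → j < k → (β ^ j) (d : D) ∉ S := by
  classical
  have h := Nat.find_spec (exists_return β S d)
  refine ⟨_, h.1, ?_, fun j h0 hj hS => Nat.find_min _ hj ⟨h0, hS⟩⟩
  simp only [keep, Equiv.ofBijective_apply, nextIn]

/-- For a cyclic permutation `τ`, removing all entries but `a, b, c, d` leaves `(a b c d)` if and
only if `b` is on the way from `a` to `c` and `d` is on the way back. -/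
theorem keepsTo_iff [Finite D] {τ : Equiv.Perm D} (hτ : ∀ x y, τ.SameCycle x y) {a b c d : D}
    (hab : a ≠ b) (hac : a ≠ c) (had : a ≠ d) (hbc : b ≠ c) (hbd : b ≠ d) (hcd : c ≠ d) :
    KeepsTo τ a b c d ↔ b ∈ arc τ a c ∧ d ∉ arc τ a c := by
  -- every element is `τ ^ i` of `a` for a unique index `i < n`
  obtain ⟨n, hn, hna, hinj⟩ : ∃ n, 0 < n ∧ (τ ^ n) a = a ∧
      ∀ i j, (τ ^ i) a = (τ ^ j) a → i % n = j % n := by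
    refine ⟨Function.minimalPeriod τ a, ?_, ?_, fun i j hij => ?_⟩
    · exact Function.minimalPeriod_pos_of_mem_periodicPts
        (τ.injective.mem_periodicPts a)
    · rw [← iterate_eq_pow]; exact Function.isPeriodicPt_minimalPeriod τ a
    · have hpos : 0 < Function.minimalPeriod τ a :=
        Function.minimalPeriod_pos_of_mem_periodicPts (τ.injective.mem_periodicPts a)
      rw [← iterate_eq_pow, ← iterate_eq_pow, ← Function.iterate_mod_minimalPeriod_eq (n := i),
        ← Function.iterate_mod_minimalPeriod_eq (n := j)] at hij
      exact (Function.iterate_eq_iterate_iff_of_lt_minimalPeriod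
        (Nat.mod_lt _ hpos) (Nat.mod_lt _ hpos)).1 hij
  have hle : ∀ i j, i < n → (τ ^ j) a = (τ ^ i) a → i ≤ j := fun i j hi h => by
    have := hinj _ _ h
    rw [Nat.mod_eq_of_lt hi] at this
    exact this ▸ Nat.mod_le _ _
  have hind : ∀ y, ∃ i < n, (τ ^ i) a = y := by
    intro y
    obtain ⟨m, rfl⟩ := (hτ a y).exists_nat_pow_eq
    refine ⟨m % n, Nat.mod_lt _ hn, ?_⟩
    rw [← iterate_eq_pow, ← iterate_eq_pow]
    refine Function.IsPeriodicPt.iterate_mod_apply ?_ m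
    rwa [Function.IsPeriodicPt, Function.IsFixedPt, iterate_eq_pow]
  obtain ⟨p, hp, hpb⟩ := hind b
  obtain ⟨q, hq, hqc⟩ := hind c
  obtain ⟨r, hr, hrd⟩ := hind d
  have harc : ∀ i < n, (τ ^ i) a ∈ arc τ a c ↔ i < q := by
    intro i hi
    constructor
    · rintro ⟨k, hk, hk'⟩
      by_contra hqi
      exact hk' q ((not_lt.1 hqi).trans (hle i k hi hk)) hqc
    · exact fun hiq => ⟨i, rfl, fun j hj h => by
        have := hle q j hq (h.trans hqc.symm)
        omega⟩
  have hp0 : p ≠ 0 := by rintro rfl; exact hab hpb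
  have hq0 : q ≠ 0 := by rintro rfl; exact hac hqc
  have hr0 : r ≠ 0 := by rintro rfl; exact had hrd
  have hpq : p ≠ q := by rintro rfl; exact hbc (hpb.symm.trans hqc)
  have hpr : p ≠ r := by rintro rfl; exact hbd (hpb.symm.trans hrd)
  have hqr : q ≠ r := by rintro rfl; exact hcd (hqc.symm.trans hrd)
  have h1 : b ∈ arc τ a c ∧ d ∉ arc τ a c ↔ p < q ∧ q < r := by
    rw [← hpb, ← hrd, harc p hp, harc r hr]; omega
  rw [h1]
  have hadd : ∀ i j, (τ ^ j) ((τ ^ i) a) = (τ ^ (i + j)) a := fun i j => by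
    rw [← mul_apply, ← pow_add, add_comm]
  constructor
  · rintro ⟨hb, hc, -, -⟩
    obtain ⟨k, -, hk, hk'⟩ := exists_keep_eq τ {a, b, c, d} ⟨a, by simp⟩
    obtain ⟨l, -, hl, hl'⟩ := exists_keep_eq τ {a, b, c, d} ⟨b, by simp⟩
    rw [hb] at hk
    rw [hc] at hl
    dsimp only at hk hk' hl hl'
    have hpk : p ≤ k := hle p k hp (hk.symm.trans hpb.symm)
    have hpq' : p < q := by
      by_contra hqp
      exact hk' q (by omega) (by omega) (by simp [hqc])
    have hpr' : p < r := by
      by_contra hrp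
      exact hk' r (by omega) (by omega) (by simp [hrd])
    refine ⟨hpq', ?_⟩
    by_contra hrq
    have hql : q ≤ p + l := hle q _ hq (by rw [← hadd, hpb, ← hl, hqc])
    refine hl' (r - p) (by omega) (by omega) ?_
    rw [← hpb, hadd, Nat.add_sub_cancel' hpr'.le, hrd]
    simp
  · rintro ⟨hpq', hqr'⟩
    have hS : ∀ i, i < n → (τ ^ i) a ∈ ({a, b, c, d} : Set D) →
        i = 0 ∨ i = p ∨ i = q ∨ i = r := by
      intro i hi h
      have hun : ∀ j < n, (τ ^ i) a = (τ ^ j) a → i = j := fun j hj h =>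
        le_antisymm (hle i j hi h.symm) (hle j i hj h)
      rcases h with h | h | h | h
      · exact Or.inl (hun 0 hn (by simpa using h))
      · exact Or.inr (Or.inl (hun p hp (h.trans hpb.symm)))
      · exact Or.inr (Or.inr (Or.inl (hun q hq (h.trans hqc.symm))))
      · exact Or.inr (Or.inr (Or.inr (hun r hr (h.trans hrd.symm))))
    have hkeep : ∀ (i k : ℕ) (x y : D) (hx : x ∈ ({a, b, c, d} : Set D)),
        (τ ^ i) a = x → (τ ^ (i + k)) a = y → y ∈ ({a, b, c, d} : Set D) → 0 < k → i + k ≤ n →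
        (∀ j, i < j → j < i + k → ¬ (j = 0 ∨ j = p ∨ j = q ∨ j = r)) →
        (keep τ {a, b, c, d} ⟨x, hx⟩ : D) = y := by
      rintro i k x y hx rfl rfl hy hk hik h
      rw [keep_eq_of_forall_notMem hk]
      · exact hadd i k
      · dsimp only; rwa [hadd]
      · intro j hj hjk hj'
        dsimp only at hj'
        rw [hadd] at hj'
        exact h (i + j) (by omega) (by omega) (hS _ (by omega) hj')
    refine ⟨hkeep 0 p a b _ rfl ?_ (by simp) ?_ ?_ ?_, hkeep p (q - p) b c _ hpb ?_ (by simp) ?_ ?_ ?_,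
      hkeep q (r - q) c d _ hqc ?_ (by simp) ?_ ?_ ?_, hkeep r (n - r) d a _ hrd ?_ (by simp) ?_ ?_ ?_⟩
    all_goals first
      | (intros; omega)
      | simpa
      | (rw [Nat.add_sub_cancel' (by omega)]; assumption)

end CyclicOrder

/-! ### The involutions `α^A` and non-crossing sets of edges -/

namespace CombMap

variable {D : Type*}

instance finite_edge [Finite D] (G : CombMap D) : Finite G.Edge := by
  unfold Edge; infer_instance

theorem αOn_apply_of_mem (G : CombMap D) {A : Set G.Edge} {d : D} (h : G.edgeOf d ∈ A) :
    G.αOn A d = G.α d := by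
  classical exact if_pos h

theorem αOn_apply_of_notMem (G : CombMap D) {A : Set G.Edge} {d : D} (h : G.edgeOf d ∉ A) :
    G.αOn A d = d := by
  classical exact if_neg h

theorem edgeOf_αOn (G : CombMap D) (A : Set G.Edge) (d : D) :
    G.edgeOf (G.αOn A d) = G.edgeOf d := by
  by_cases h : G.edgeOf d ∈ A
  · rw [αOn_apply_of_mem G h, edgeOf_α]
  · rw [αOn_apply_of_notMem G h]

theorem αOn_union (G : CombMap D) {A B : Set G.Edge} (h : Disjoint A B) :
    G.αOn (A ∪ B) = G.αOn A * G.αOn B := by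
  ext d
  rw [mul_apply]
  by_cases hB : G.edgeOf d ∈ B
  · rw [αOn_apply_of_mem G (Or.inr hB), αOn_apply_of_notMem G (A := A), αOn_apply_of_mem G hB]
    rw [edgeOf_αOn]
    exact fun hA => Set.disjoint_left.1 h hA hB
  · rw [αOn_apply_of_notMem G hB]
    by_cases hA : G.edgeOf d ∈ A
    · rw [αOn_apply_of_mem G (Or.inl hA), αOn_apply_of_mem G hA]
    · rw [αOn_apply_of_notMem G hA, αOn_apply_of_notMem G]
      exact fun h' => h'.elim hA hB

theorem αOn_empty (G : CombMap D) : G.αOn ∅ = 1 :=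
  Equiv.ext fun _ => αOn_apply_of_notMem G (Set.notMem_empty _)

theorem αOn_univ (G : CombMap D) : G.αOn Set.univ = G.α :=
  Equiv.ext fun _ => αOn_apply_of_mem G (Set.mem_univ _)

open Classical in
theorem αOn_singleton (G : CombMap D) (d : D) :
    G.αOn {G.edgeOf d} = Equiv.swap d (G.α d) := by
  ext x
  by_cases h : G.edgeOf x ∈ ({G.edgeOf d} : Set G.Edge)
  · rw [αOn_apply_of_mem G h]
    rcases (G.edgeOf_eq_iff _ _).1 h with rfl | h'
    · simp
    · rw [h', G.α_invol, Equiv.swap_apply_right]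
  · rw [αOn_apply_of_notMem G h, Equiv.swap_apply_of_ne_of_ne]
    · rintro rfl; exact h rfl
    · rintro rfl; exact h (G.edgeOf_α d)

theorem αOn_mul_self (G : CombMap D) (A : Set G.Edge) : G.αOn A * G.αOn A = 1 := by
  ext d
  rw [mul_apply]
  by_cases h : G.edgeOf d ∈ A
  · rw [αOn_apply_of_mem G h, αOn_apply_of_mem G (by rwa [edgeOf_α]), G.α_invol]; rfl
  · rw [αOn_apply_of_notMem G h, αOn_apply_of_notMem G h]; rfl

theorem exists_edgeOf (G : CombMap D) (e : G.Edge) : ∃ d, G.edgeOf d = e := Quotient.exists_rep e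

theorem numCycles_αOn_mul_le [Finite D] (G : CombMap D) (U : Set G.Edge) (β : Equiv.Perm D) :
    numCycles (G.αOn U * β) ≤ numCycles β + U.ncard := by
  classical
  induction U, U.toFinite using Set.Finite.induction_on with
  | empty => simp [αOn_empty]
  | @insert e U he _ ih =>
    obtain ⟨d, rfl⟩ := G.exists_edgeOf e
    rw [Set.insert_eq, αOn_union G (Set.disjoint_singleton_left.2 he), ← Set.insert_eq,
      Set.ncard_insert_of_notMem he, αOn_singleton, mul_assoc]
    have := numCycles_swap_mul_le (G.αOn U * β) d (G.α d)
    omega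

/-- If multiplying a cyclic permutation by the transpositions of a set of edges gives the largest
possible number of cycles, then these edges, as chords of the cycle, do not cross: a crossing pair
of transpositions would first split and then merge cycles. -/
theorem α_mem_arc_of_le_numCycles [Finite D] (G : CombMap D) {U : Set G.Edge} {τ : Equiv.Perm D}
    (hτ : IsCyclic τ) (hU : U.ncard + 1 ≤ numCycles (G.αOn U * τ)) {d₀ d : D}
    (h₀ : G.edgeOf d₀ ∈ U) (hd : G.edgeOf d ∈ U) (hne : G.edgeOf d ≠ G.edgeOf d₀)
    (h : d ∈ arc τ d₀ (G.α d₀)) : G.α d ∈ arc τ d₀ (G.α d₀) := by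
  classical
  by_contra hn
  have hsc := (isCyclic_iff τ).1 hτ
  set β := Equiv.swap d₀ (G.α d₀) * τ with hβ
  have h1 : ¬ β.SameCycle d (G.α d) := fun h' => hn <| mem_of_sameCycle
    (fun x hx => swap_mul_apply_mem_arc (hsc _ _) (G.α_fixedPointFree d₀).symm hx) h' h
  have h2 : numCycles β ≤ numCycles τ + 1 := numCycles_swap_mul_le _ _ _
  have h3 := numCycles_swap_mul_add_one_le h1
  have hU1 : U = (U \ {G.edgeOf d, G.edgeOf d₀}) ∪ ({G.edgeOf d} ∪ {G.edgeOf d₀}) := by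
    rw [← Set.insert_eq, Set.sdiff_union_self, Set.union_eq_left.2]
    rintro x (rfl | rfl) <;> assumption
  have h4 : G.αOn U * τ =
      G.αOn (U \ {G.edgeOf d, G.edgeOf d₀}) * (Equiv.swap d (G.α d) * β) := by
    conv_lhs => rw [hU1]
    rw [αOn_union, αOn_union, αOn_singleton, αOn_singleton, hβ]
    · simp only [mul_assoc]
    · simpa using hne
    · rw [← Set.insert_eq]; exact Set.disjoint_sdiff_left
  have h5 := numCycles_αOn_mul_le G (U \ {G.edgeOf d, G.edgeOf d₀})
    (Equiv.swap d (G.α d) * β)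
  have h6 : (U \ {G.edgeOf d, G.edgeOf d₀}).ncard + 2 = U.ncard := by
    rw [← Set.ncard_pair hne]
    exact Set.ncard_sdiff_add_ncard_of_subset (by rintro x (rfl | rfl) <;> assumption)
  rw [IsCyclic] at hτ
  rw [h4] at hU
  omega

end CombMap

/-! ### Walks, paths and forests in abstract graphs -/

section Walks

variable {V E : Type*}

/-- The vertices `x` and `y` are joined by a walk with all its edges in `F`. -/
def JoinedBy (G : Graph V E) (F : Set E) (x y : V) : Prop :=
  Relation.ReflTransGen (G.restrict F).Adj x y

theorem JoinedBy.trans {G : Graph V E} {F : Set E} {x y z : V} (h : JoinedBy G F x y)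
    (h' : JoinedBy G F y z) : JoinedBy G F x z :=
  Relation.ReflTransGen.trans h h'

theorem JoinedBy.of_isLink {G : Graph V E} {F : Set E} {e : E} {x y : V} (h : G.IsLink e x y)
    (he : e ∈ F) : JoinedBy G F x y :=
  Relation.ReflTransGen.single ⟨e, he, h⟩

/-- A relation of vertices that contains the ends of all edges in `F`, and is reflexive and
transitive, contains all pairs of vertices joined by walks in `F`. -/
theorem JoinedBy.lift {G : Graph V E} {F : Set E} {r : V → V → Prop} (hr : ∀ x, r x x)
    (ht : ∀ x y z, r x y → r y z → r x z) (h : ∀ e ∈ F, ∀ x y, G.IsLink e x y → r x y) {x y : V}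
    (hxy : JoinedBy G F x y) : r x y := by
  induction hxy with
  | refl => exact hr x
  | tail _ h' ih =>
    obtain ⟨e, he, hl⟩ := h'
    exact ht _ _ _ ih (h e he _ _ hl)

theorem JoinedBy.symm {G : Graph V E} {F : Set E} {x y : V} (h : JoinedBy G F x y) :
    JoinedBy G F y x :=
  JoinedBy.lift (r := fun x y => JoinedBy G F y x) (fun _ => Relation.ReflTransGen.refl)
    (fun _ _ _ h h' => JoinedBy.trans h' h)
    (fun _ he _ _ hl => JoinedBy.of_isLink hl.symm he) h

theorem JoinedBy.mono {G : Graph V E} {F F' : Set E} (hF : F ⊆ F') {x y : V}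
    (h : JoinedBy G F x y) : JoinedBy G F' x y :=
  JoinedBy.lift (fun _ => Relation.ReflTransGen.refl) (fun _ _ _ h h' => JoinedBy.trans h h')
    (fun _ he _ _ hl => JoinedBy.of_isLink hl (hF he)) h

/-- `T` contains no cycle: the ends of an edge of `T` are not joined by the other edges of `T`. -/
def IsForest (G : Graph V E) (T : Set E) : Prop :=
  ∀ e ∈ T, ∀ x y, G.IsLink e x y → ¬ JoinedBy G (T \ {e}) x y

theorem IsForest.mono {G : Graph V E} {T U : Set E} (hT : IsForest G T) (h : U ⊆ T) :
    IsForest G U := fun e he x y hl hj =>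
  hT e (h he) x y hl (hj.mono (Set.sdiff_subset_sdiff_left h))

/-- The list `w` of steps is a path of `G` from `x` to `y`, not repeating a vertex. -/
inductive IsPath (G : Graph V E) (y : V) : V → List (V × E × V) → Prop
  | nil : IsPath G y y []
  | cons {x e z w} : G.IsLink e x z → IsPath G y z w → x ≠ y → x ∉ w.map (fun s => s.1) →
      IsPath G y x ((x, e, z) :: w)

namespace IsPath

variable {G : Graph V E} {x y : V} {w : List (V × E × V)}

theorem exists_of_mem (h : IsPath G y x w) {u : V} (hu : u ∈ w.map fun s => s.1) :
    ∃ w', IsPath G y u w' := by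
  induction h with
  | nil => simp at hu
  | @cons x e z w hl hp hxy hx ih =>
    rcases List.mem_cons.1 hu with rfl | hu
    · exact ⟨_, .cons hl hp hxy hx⟩
    · exact ih hu

theorem exists_of_reflTransGen (h : Relation.ReflTransGen G.Adj x y) : ∃ w, IsPath G y x w := by
  induction h using Relation.ReflTransGen.head_induction_on with
  | refl => exact ⟨[], .nil⟩
  | @head x z h _ ih =>
    obtain ⟨e, hl⟩ := h
    obtain ⟨w, hw⟩ := ih
    by_cases hxy : x = y
    · exact ⟨[], hxy ▸ .nil⟩
    by_cases hx : x ∈ w.map fun s => s.1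
    · exact hw.exists_of_mem hx
    · exact ⟨_, .cons hl hw hxy hx⟩

theorem isLink (h : IsPath G y x w) : ∀ s ∈ w, G.IsLink s.2.1 s.1 s.2.2 := by
  induction h with
  | nil => simp
  | cons hl _ _ _ ih =>
    intro s hs
    rcases List.mem_cons.1 hs with rfl | hs
    · exact hl
    · exact ih s hs

theorem nodup_vertices (h : IsPath G y x w) : (w.map fun s => s.1).Nodup := by
  induction h with
  | nil => simp
  | cons _ _ _ hx ih => exact List.nodup_cons.2 ⟨hx, ih⟩

theorem end_notMem (h : IsPath G y x w) : y ∉ w.map fun s => s.1 := by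
  induction h with
  | nil => simp
  | cons _ _ hxy _ ih =>
    rw [List.map_cons, List.mem_cons, not_or]
    exact ⟨hxy.symm, ih⟩

theorem start_eq_or_mem (h : IsPath G y x w) : x = y ∨ x ∈ w.map fun s => s.1 := by
  cases h <;> simp

theorem target_eq_or_mem (h : IsPath G y x w) :
    ∀ s ∈ w, s.2.2 = y ∨ s.2.2 ∈ w.map fun s => s.1 := by
  induction h with
  | nil => simp
  | cons _ hp _ _ ih =>
    intro s hs
    rw [List.map_cons, List.mem_cons]
    rcases List.mem_cons.1 hs with rfl | hs
    · exact hp.start_eq_or_mem.imp_right Or.inr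
    · exact (ih s hs).imp_right Or.inr

theorem nodup_edges (h : IsPath G y x w) : (w.map fun s => s.2.1).Nodup := by
  induction h with
  | nil => simp
  | @cons x e z w hl hp hxy hx ih =>
    refine List.nodup_cons.2 ⟨fun he => ?_, ih⟩
    -- a later step along the same edge would meet the vertex `x` again
    obtain ⟨s, hs, rfl⟩ := List.mem_map.1 he
    rcases hl.left_eq_or_eq (hp.isLink s hs) with h | h
    · exact hx (List.mem_map.2 ⟨s, hs, h.symm⟩)
    · rcases hp.target_eq_or_mem s hs with h' | h'
      · exact hxy (h.trans h')
      · exact hx (h ▸ h')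

theorem isChain_cons (h : IsPath G y x w) :
    ∀ s : V × E × V, s.2.2 = x → (s :: w).IsChain (fun s t => s.2.2 = t.1) ∧
      ((s :: w).getLast (List.cons_ne_nil _ _)).2.2 = y := by
  induction h with
  | nil => intro s hs; simpa using hs
  | @cons x e z w _ _ _ _ ih =>
    intro s hs
    obtain ⟨h1, h2⟩ := ih (x, e, z) rfl
    refine ⟨List.isChain_cons_cons.2 ⟨hs, h1⟩, ?_⟩
    rw [List.getLast_cons (List.cons_ne_nil _ _), h2]

/-- A path together with an edge that joins its ends is a cycle. -/
theorem isCycleWalk_cons {G' : Graph V E} (h : IsPath G y x w) (hG : G ≤ G') {e : E}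
    (he : e ∉ w.map fun s => s.2.1) (hl : G'.IsLink e y x) :
    IsCycleWalk G' ((y, e, x) :: w) where
  ne_nil := List.cons_ne_nil _ _
  link s hs := by
    rcases List.mem_cons.1 hs with rfl | hs
    · exact hl
    · exact (h.isLink s hs).mono hG
  chain := (h.isChain_cons (y, e, x) rfl).1
  closed := (h.isChain_cons (y, e, x) rfl).2
  nodup_vertices := List.nodup_cons.2 ⟨h.end_notMem, h.nodup_vertices⟩
  nodup_edges := List.nodup_cons.2 ⟨he, h.nodup_edges⟩

end IsPath

/-- Along a walk, the increments of a function of the vertices add up to the total increment. -/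
theorem sum_increments (p : V → ℤ) (w : List (V × E × V)) :
    ∀ s : V × E × V, (s :: w).IsChain (fun s t => s.2.2 = t.1) →
      ((s :: w).map fun t => p t.2.2 - p t.1).sum =
        p ((s :: w).getLast (List.cons_ne_nil _ _)).2.2 - p s.1 := by
  induction w with
  | nil => intro s _; simp
  | cons t w ih =>
    intro s h
    obtain ⟨h1, h2⟩ := List.isChain_cons_cons.1 h
    rw [List.map_cons, List.sum_cons, ih t h2, List.getLast_cons (List.cons_ne_nil _ _), h1]
    ring

theorem IsCycleWalk.sum_increments_eq_zero {G : Graph V E} {w : List (V × E × V)}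
    (h : IsCycleWalk G w) (p : V → ℤ) : (w.map fun t => p t.2.2 - p t.1).sum = 0 := by
  obtain ⟨hn, -, hc, hcl, -, -⟩ := h
  obtain ⟨s, w, rfl⟩ := List.exists_cons_of_ne_nil hn
  rw [sum_increments p w s hc, hcl]
  simp

theorem joinedBy_of_isChain {G : Graph V E} {F : Set E} (w : List (V × E × V)) :
    ∀ s : V × E × V, (s :: w).IsChain (fun s t => s.2.2 = t.1) →
      (∀ t ∈ w, t.2.1 ∈ F ∧ G.IsLink t.2.1 t.1 t.2.2) →
      JoinedBy G F s.2.2 ((s :: w).getLast (List.cons_ne_nil _ _)).2.2 := by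
  induction w with
  | nil => exact fun s _ _ => Relation.ReflTransGen.refl
  | cons t w ih =>
    intro s h hw
    obtain ⟨h1, h2⟩ := List.isChain_cons_cons.1 h
    rw [List.getLast_cons (List.cons_ne_nil _ _), h1]
    have ht := hw t List.mem_cons_self
    exact (JoinedBy.of_isLink ht.2 ht.1).trans
      (ih t h2 fun u hu => hw u (List.mem_cons_of_mem _ hu))

theorem IsForest.not_isCycleWalk {G : Graph V E} {T : Set E} (h : IsForest G T)
    (w : List (V × E × V)) : ¬ IsCycleWalk (G.restrict T) w := by
  rintro ⟨hn, hl, hc, hcl, -, he⟩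
  obtain ⟨s, w, rfl⟩ := List.exists_cons_of_ne_nil hn
  have hs := hl s List.mem_cons_self
  have hj : JoinedBy G (T \ {s.2.1}) s.2.2 s.1 := by
    have := joinedBy_of_isChain (G := G) (F := T \ {s.2.1}) w s hc fun t ht => by
      have hlt := hl t (List.mem_cons_of_mem _ ht)
      refine ⟨⟨hlt.1, fun h' => ?_⟩, hlt.2⟩
      rw [List.map_cons, List.nodup_cons] at he
      exact he.1 (List.mem_map.2 ⟨t, ht, h'⟩)
    rwa [hcl] at this
  exact h _ hs.1 _ _ hs.2.symm hj

theorem IsSpanningTree.isForest {G : Graph V E} {T : Set E} (h : IsSpanningTree G T) :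
    IsForest G T := by
  intro e he x y hl hj
  obtain ⟨w, hw⟩ := IsPath.exists_of_reflTransGen hj.symm
  refine h.acyclic _ (hw.isCycleWalk_cons (e := e) ?_ ?_ ⟨he, hl⟩)
  · exact Graph.restrict_mono_right G Set.sdiff_subset
  · intro h'
    obtain ⟨s, hs, rfl⟩ := List.mem_map.1 h'
    exact (hw.isLink s hs).1.2 rfl

theorem isSpanningTree_of_isForest {G : Graph V E} {T : Set E} (hT : T ⊆ E(G))
    (hV : V(G).Nonempty) (hc : ∀ x ∈ V(G), ∀ y ∈ V(G), JoinedBy G T x y) (hf : IsForest G T) :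
    IsSpanningTree G T :=
  ⟨hT, ⟨hV, hc⟩, hf.not_isCycleWalk⟩

/-- Every finite connected graph has a spanning tree: a minimal set of edges joining all
vertices. -/
theorem exists_isSpanningTree [Finite E] {G : Graph V E} (hV : V(G).Nonempty)
    (hc : ∀ x ∈ V(G), ∀ y ∈ V(G), JoinedBy G E(G) x y) : ∃ T, IsSpanningTree G T := by
  obtain ⟨T, hT⟩ := (Set.toFinite {T : Set E | T ⊆ E(G) ∧
    ∀ x ∈ V(G), ∀ y ∈ V(G), JoinedBy G T x y}).exists_minimal ⟨E(G), subset_rfl, hc⟩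
  refine ⟨T, isSpanningTree_of_isForest hT.1.1 hV hT.1.2 fun e he x y hl hj => ?_⟩
  refine (hT.2 (y := T \ {e}) ⟨Set.sdiff_subset.trans hT.1.1, fun u hu v hv => ?_⟩
    Set.sdiff_subset he).2 rfl
  refine JoinedBy.lift (fun _ => Relation.ReflTransGen.refl) (fun _ _ _ h h' => JoinedBy.trans h h')
    (fun f hf a b hab => ?_) (hT.1.2 u hu v hv)
  by_cases hfe : f = e
  · subst hfe
    rcases hab.eq_and_eq_or_eq_and_eq hl with ⟨rfl, rfl⟩ | ⟨rfl, rfl⟩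
    · exact hj
    · exact hj.symm
  · exact JoinedBy.of_isLink hab ⟨hf, hfe⟩

end Walks

/-! ### Sides of the edges of a spanning tree -/

namespace DirGraph

variable {V E : Type*}

/-- `X` is one of the two sides of the cut that the edge `f` of `T` defines: it contains the head
of `f` and not the tail, and no other edge of `T` leads out of it. -/
structure IsSide (H : DirGraph V E) (T : Set E) (f : E) (X : Set V) : Prop where
  head_mem : H.head f ∈ X
  tail_notMem : H.tail f ∉ X
  mem_iff : ∀ i ∈ T, i ≠ f → (H.head i ∈ X ↔ H.tail i ∈ X)

open Classical in
/-- The increment along an edge of the indicator function of a set of vertices. -/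
def cut (H : DirGraph V E) (X : Set V) (i : E) : ℤ :=
  (if H.head i ∈ X then 1 else 0) - if H.tail i ∈ X then 1 else 0

variable {H : DirGraph V E} {T : Set E} {X : Set V} {e f i : E}

theorem isLink_toGraph (H : DirGraph V E) (i : E) : H.toGraph.IsLink i (H.tail i) (H.head i) :=
  Or.inl ⟨rfl, rfl⟩

theorem cut_eq_zero (h : H.head i ∈ X ↔ H.tail i ∈ X) : H.cut X i = 0 := by
  by_cases h' : H.tail i ∈ X <;> simp [cut, h, h']

theorem IsSide.cut_self (hX : H.IsSide T f X) : H.cut X f = 1 := by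
  simp [cut, hX.head_mem, hX.tail_notMem]

theorem mem_iff_of_joinedBy {F : Set E} (h : ∀ i ∈ F, (H.head i ∈ X ↔ H.tail i ∈ X)) {x y : V}
    (hxy : JoinedBy H.toGraph F x y) : x ∈ X ↔ y ∈ X := by
  refine JoinedBy.lift (r := fun x y => x ∈ X ↔ y ∈ X) (fun _ => Iff.rfl)
    (fun _ _ _ h h' => h.trans h') (fun i hi x y hl => ?_) hxy
  rcases hl with ⟨rfl, rfl⟩ | ⟨rfl, rfl⟩
  · exact (h i hi).symm
  · exact h i hi

theorem IsSide.mem_iff_of_joinedBy (hX : H.IsSide T f X) {x y : V}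
    (hxy : JoinedBy H.toGraph (T \ {f}) x y) : x ∈ X ↔ y ∈ X :=
  DirGraph.mem_iff_of_joinedBy (fun i hi => hX.mem_iff i hi.1 hi.2) hxy

theorem isForest_of_isSide (h : ∀ f ∈ T, ∃ X, H.IsSide T f X) : IsForest H.toGraph T := by
  intro f hf x y hl hj
  obtain ⟨X, hX⟩ := h f hf
  have := hX.mem_iff_of_joinedBy hj
  rcases hl with ⟨rfl, rfl⟩ | ⟨rfl, rfl⟩
  · exact hX.tail_notMem (this.2 hX.head_mem)
  · exact hX.tail_notMem (this.1 hX.head_mem)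

theorem exists_isSide (hT : IsForest H.toGraph T) (hf : f ∈ T) : ∃ X, H.IsSide T f X := by
  refine ⟨{v | JoinedBy H.toGraph (T \ {f}) v (H.head f)}, Relation.ReflTransGen.refl,
    hT f hf _ _ (H.isLink_toGraph f), fun i hi hif => ?_⟩
  have := JoinedBy.of_isLink (H.isLink_toGraph i) (F := T \ {f}) ⟨hi, hif⟩
  exact ⟨fun h => this.trans h, fun h => this.symm.trans h⟩

theorem joinedBy_of_isSpanningTree (hT : IsSpanningTree H.toGraph T) (x y : V) :
    JoinedBy H.toGraph T x y :=
  hT.connected.2 x trivial y trivial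

/-- Without `f`, a spanning tree still joins every vertex to one of the ends of `f`. -/
theorem joinedBy_head_or_tail (hT : IsSpanningTree H.toGraph T) (f : E) (v : V) :
    JoinedBy H.toGraph (T \ {f}) v (H.head f) ∨ JoinedBy H.toGraph (T \ {f}) v (H.tail f) := by
  have hv := joinedBy_of_isSpanningTree hT (H.head f) v
  induction hv with
  | refl => exact Or.inl Relation.ReflTransGen.refl
  | @tail x y _ h ih =>
    obtain ⟨i, hi, hl⟩ := h
    by_cases hif : i = f
    · subst hif
      rcases hl with ⟨-, rfl⟩ | ⟨-, rfl⟩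
      · exact Or.inl Relation.ReflTransGen.refl
      · exact Or.inr Relation.ReflTransGen.refl
    · have hyx := (JoinedBy.of_isLink hl (F := T \ {f}) ⟨hi, hif⟩).symm
      exact ih.imp hyx.trans hyx.trans

theorem IsSide.joinedBy_head (hX : H.IsSide T f X) (hT : IsSpanningTree H.toGraph T) {v : V}
    (hv : v ∈ X) : JoinedBy H.toGraph (T \ {f}) v (H.head f) :=
  (joinedBy_head_or_tail hT f v).resolve_right fun h => hX.tail_notMem ((hX.mem_iff_of_joinedBy h).1 hv)

theorem IsSide.joinedBy_tail (hX : H.IsSide T f X) (hT : IsSpanningTree H.toGraph T) {v : V}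
    (hv : v ∉ X) : JoinedBy H.toGraph (T \ {f}) v (H.tail f) :=
  (joinedBy_head_or_tail hT f v).resolve_left fun h => hv ((hX.mem_iff_of_joinedBy h).2 hX.head_mem)

/-! ### Fundamental cocycles -/

theorem deleteEdges_adj_iff {F : Set E} : (H.toGraph.deleteEdges F).Adj =
    (H.toGraph.restrict Fᶜ).Adj := by
  ext x y
  exact exists_congr fun i => by simp [and_comm]

theorem graphConnected_deleteEdges_iff {F : Set E} :
    GraphConnected (H.toGraph.deleteEdges F) ↔
      Nonempty V ∧ ∀ x y, JoinedBy H.toGraph Fᶜ x y := by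
  rw [GraphConnected, deleteEdges_adj_iff]
  simp only [JoinedBy, Graph.vertexSet_deleteEdges]
  exact and_congr Set.nonempty_iff_univ_nonempty.symm
    ⟨fun h x y => h x trivial y trivial, fun h x _ y _ => h x y⟩

theorem sameComponent_deleteEdges_iff {F : Set E} {x y : V} :
    SameComponent (H.toGraph.deleteEdges F) x y ↔ JoinedBy H.toGraph Fᶜ x y := by
  rw [SameComponent, deleteEdges_adj_iff]
  exact ⟨fun h => h.2.2, fun h => ⟨trivial, trivial, h⟩⟩

/-- A disconnecting set of edges that contains no edge of the spanning tree except `f` contains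
all edges between the two sides of `f`, as each of these would reconnect the sides. -/
theorem IsSide.subset_of_not_connected (hX : H.IsSide T f X) (hT : IsSpanningTree H.toGraph T)
    {F : Set E} (hF : F ∩ T ⊆ {f}) (hc : ¬ GraphConnected (H.toGraph.deleteEdges F)) :
    {i | ¬ (H.head i ∈ X ↔ H.tail i ∈ X)} ⊆ F := by
  intro i hi
  by_contra hiF
  refine hc (graphConnected_deleteEdges_iff.2 ⟨⟨H.head f⟩, ?_⟩)
  have hsub : T \ {f} ⊆ Fᶜ := fun j hj hjF => hj.2 (hF ⟨hjF, hj.1⟩)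
  have hlink : JoinedBy H.toGraph Fᶜ (H.tail i) (H.head i) :=
    JoinedBy.of_isLink (H.isLink_toGraph i) hiF
  have hends : JoinedBy H.toGraph Fᶜ (H.tail f) (H.head f) := by
    by_cases hh : H.head i ∈ X
    · have ht : H.tail i ∉ X := fun ht => hi ⟨fun _ => ht, fun _ => hh⟩
      exact (((hX.joinedBy_tail hT ht).mono hsub).symm.trans hlink).trans
        ((hX.joinedBy_head hT hh).mono hsub)
    · have ht : H.tail i ∈ X := by
        by_contra ht
        exact hi ⟨fun h => absurd h hh, fun h => absurd h ht⟩
      exact (((hX.joinedBy_tail hT hh).mono hsub).symm.trans hlink.symm).trans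
        ((hX.joinedBy_head hT ht).mono hsub)
  have hall : ∀ v, JoinedBy H.toGraph Fᶜ v (H.head f) := fun v => by
    by_cases hv : v ∈ X
    · exact (hX.joinedBy_head hT hv).mono hsub
    · exact ((hX.joinedBy_tail hT hv).mono hsub).trans hends
  exact fun x y => (hall x).trans (hall y).symm

theorem IsSide.not_connected (hX : H.IsSide T f X) :
    ¬ GraphConnected (H.toGraph.deleteEdges {i | ¬ (H.head i ∈ X ↔ H.tail i ∈ X)}) := by
  rw [graphConnected_deleteEdges_iff]
  rintro ⟨-, h⟩
  refine hX.tail_notMem ((DirGraph.mem_iff_of_joinedBy (fun i hi => ?_)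
    (h (H.head f) (H.tail f))).1 hX.head_mem)
  exact not_not.1 hi

/-- The edges between the two sides of `f` form the only cocycle that meets the spanning tree in `f`
alone. -/
theorem IsSide.isCocycle_iff (hX : H.IsSide T f X) (hT : IsSpanningTree H.toGraph T)
    (hf : f ∈ T) {C : Set E} :
    IsCocycle H.toGraph C ∧ C ∩ T = {f} ↔ C = {i | ¬ (H.head i ∈ X ↔ H.tail i ∈ X)} := by
  have hTf : {i | ¬ (H.head i ∈ X ↔ H.tail i ∈ X)} ∩ T = {f} := by
    ext i
    constructor
    · rintro ⟨hi, hiT⟩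
      by_contra hif
      exact hi (hX.mem_iff i hiT hif)
    · rintro rfl
      exact ⟨fun h => hX.tail_notMem (h.1 hX.head_mem), hf⟩
  constructor
  · rintro ⟨hC, hCT⟩
    have hsub := hX.subset_of_not_connected hT hCT.subset hC.1.2
    exact (hC.2 ⟨Set.subset_univ _, hX.not_connected⟩ hsub).antisymm hsub
  · rintro rfl
    refine ⟨⟨⟨Set.subset_univ _, hX.not_connected⟩, fun F hF hsub => ?_⟩, hTf⟩
    exact hX.subset_of_not_connected hT ((Set.inter_subset_inter_left T hsub).trans hTf.subset)
      hF.2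

theorem IsSide.cocycleVector_eq (hX : H.IsSide T f X) (hT : IsSpanningTree H.toGraph T)
    (hf : f ∈ T) (i : E) : H.cocycleVector T f i = H.cut X i := by
  have key : ∀ v, (∃ C, IsCocycle H.toGraph C ∧ C ∩ T = {f} ∧ i ∈ C ∧
      SameComponent (H.toGraph.deleteEdges C) (H.head i) v) ↔
      ¬ (H.head i ∈ X ↔ H.tail i ∈ X) ∧
        JoinedBy H.toGraph {i | ¬ (H.head i ∈ X ↔ H.tail i ∈ X)}ᶜ (H.head i) v := by
    intro v
    constructor
    · rintro ⟨C, h1, h2, h3, h4⟩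
      obtain rfl := (hX.isCocycle_iff hT hf).1 ⟨h1, h2⟩
      exact ⟨h3, sameComponent_deleteEdges_iff.1 h4⟩
    · rintro ⟨h3, h4⟩
      obtain ⟨h1, h2⟩ := (hX.isCocycle_iff hT hf).2 rfl
      exact ⟨_, h1, h2, h3, sameComponent_deleteEdges_iff.2 h4⟩
  have hinv : ∀ x y, JoinedBy H.toGraph {i | ¬ (H.head i ∈ X ↔ H.tail i ∈ X)}ᶜ x y →
      (x ∈ X ↔ y ∈ X) := fun x y h =>
    DirGraph.mem_iff_of_joinedBy (fun i hi => not_not.1 hi) h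
  have hsub : T \ {f} ⊆ {i | ¬ (H.head i ∈ X ↔ H.tail i ∈ X)}ᶜ := fun j hj =>
    not_not.2 (hX.mem_iff j hj.1 hj.2)
  have hhead : JoinedBy H.toGraph {i | ¬ (H.head i ∈ X ↔ H.tail i ∈ X)}ᶜ (H.head i) (H.head f) ↔
      H.head i ∈ X :=
    ⟨fun h => (hinv _ _ h).2 hX.head_mem, fun h => (hX.joinedBy_head hT h).mono hsub⟩
  have htail : JoinedBy H.toGraph {i | ¬ (H.head i ∈ X ↔ H.tail i ∈ X)}ᶜ (H.head i) (H.tail f) ↔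
      H.head i ∉ X :=
    ⟨fun h h' => hX.tail_notMem ((hinv _ _ h).1 h'), fun h => (hX.joinedBy_tail hT h).mono hsub⟩
  rw [cocycleVector, key, key, hhead, htail, cut]
  by_cases h1 : H.head i ∈ X <;> by_cases h2 : H.tail i ∈ X <;> simp [h1, h2]

/-! ### Fundamental cycles -/

open Classical in
/-- The increments of the indicator function of a side of `f` along a cycle through `e` and `f`
come from `e` and `f` alone. -/
theorem IsSide.increments_of_isCycleWalk (hX : H.IsSide T f X) (hef : e ≠ f)
    {w : List (V × E × V)} (hw : IsCycleWalk (H.toGraph.restrict (T ∪ {e})) w)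
    {s t : V × E × V} (hs : s ∈ w) (ht : t ∈ w) (hse : s.2.1 = e) (htf : t.2.1 = f) :
    ((if s.2.2 ∈ X then 1 else 0) - (if s.1 ∈ X then 1 else 0) : ℤ) +
      ((if t.2.2 ∈ X then 1 else 0) - (if t.1 ∈ X then 1 else 0)) = 0 := by
  have h := hw.sum_increments_eq_zero fun v => if v ∈ X then 1 else 0
  have hnd : w.Nodup := List.Nodup.of_map _ hw.nodup_edges
  have hinj : ∀ u ∈ w, ∀ v ∈ w, u.2.1 = v.2.1 → u = v := fun u hu v hv huv =>
    List.inj_on_of_nodup_map hw.nodup_edges hu hv huv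
  rw [← List.sum_toFinset _ hnd] at h
  refine Eq.trans (Eq.symm ?_) h
  refine Finset.sum_eq_add_of_mem s t (List.mem_toFinset.2 hs) (List.mem_toFinset.2 ht) ?_ fun u hu hne => ?_
  · rintro rfl; exact hef (hse.symm.trans htf)
  · have hu' : u ∈ w := by simpa using hu
    have h1 : u.2.1 ≠ e := fun h => hne.1 (hinj u hu' s hs (h.trans hse.symm))
    have h2 : u.2.1 ≠ f := fun h => hne.2 (hinj u hu' t ht (h.trans htf.symm))
    have hl := hw.link u hu'
    have h3 := hX.mem_iff u.2.1 (hl.1.resolve_right h1) h2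
    rcases hl.2 with ⟨h4, h5⟩ | ⟨h4, h5⟩ <;> rw [h4, h5] <;> simp [h3]

/-- The path in a spanning tree between the ends of `e`, together with `e`, is a cycle. -/
theorem exists_isCycleWalk (hT : IsSpanningTree H.toGraph T) (he : e ∉ T) :
    ∃ w, IsPath (H.toGraph.restrict T) (H.tail e) (H.head e) w ∧
      IsCycleWalk (H.toGraph.restrict (T ∪ {e})) ((H.tail e, e, H.head e) :: w) := by
  obtain ⟨w, hw⟩ := IsPath.exists_of_reflTransGen
    (joinedBy_of_isSpanningTree hT (H.head e) (H.tail e))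
  refine ⟨w, hw, hw.isCycleWalk_cons (Graph.restrict_mono_right _ Set.subset_union_left) ?_
    ⟨Or.inr rfl, H.isLink_toGraph e⟩⟩
  intro h
  obtain ⟨s, hs, rfl⟩ := List.mem_map.1 h
  exact he (hw.isLink s hs).1

theorem cycleVector_self (hT : IsSpanningTree H.toGraph T) (he : e ∉ T) :
    H.cycleVector T e e = 1 := by
  obtain ⟨w, -, hw⟩ := exists_isCycleWalk hT he
  exact if_pos ⟨_, hw, List.mem_cons_self, List.mem_cons_self⟩

theorem cycleVector_of_notMem (hi : i ∉ T) (hie : i ≠ e) : H.cycleVector T e i = 0 := by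
  have : i ∉ T ∪ {e} := fun h => h.elim hi hie
  rw [cycleVector, if_neg, if_neg]
  · rintro ⟨w, hw, -, h⟩; exact this (hw.link _ h).1
  · rintro ⟨w, hw, -, h⟩; exact this (hw.link _ h).1

/-- The fundamental cycle of `e` passes the tree edge `f` if and only if `e` joins the two sides of
`f`; as a closed walk crosses back, it passes `f` in the opposite sense to `e`. -/
theorem IsSide.cycleVector_eq (hX : H.IsSide T f X) (hT : IsSpanningTree H.toGraph T)
    (hf : f ∈ T) (he : e ∉ T) : H.cycleVector T e f = - H.cut X e := by
  classical
  have hef : e ≠ f := fun h => he (h ▸ hf)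
  have key1 : ∀ w, IsCycleWalk (H.toGraph.restrict (T ∪ {e})) w → (H.tail e, e, H.head e) ∈ w →
      (H.tail f, f, H.head f) ∈ w → H.cut X e = -1 := by
    intro w hw h1 h2
    have h3 := hX.cut_self
    have h := hX.increments_of_isCycleWalk hef hw h1 h2 rfl rfl
    simp only [cut] at h3 ⊢
    dsimp only at h
    linarith
  have key2 : ∀ w, IsCycleWalk (H.toGraph.restrict (T ∪ {e})) w → (H.tail e, e, H.head e) ∈ w →
      (H.head f, f, H.tail f) ∈ w → H.cut X e = 1 := by
    intro w hw h1 h2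
    have h3 := hX.cut_self
    have h := hX.increments_of_isCycleWalk hef hw h1 h2 rfl rfl
    simp only [cut] at h3 ⊢
    dsimp only at h
    linarith
  obtain ⟨w, hp, hw⟩ := exists_isCycleWalk hT he
  have hsum := hw.sum_increments_eq_zero fun v => if v ∈ X then 1 else 0
  rw [List.map_cons, List.sum_cons] at hsum
  have hsum' : H.cut X e + (w.map fun t : V × E × V =>
    ((if t.2.2 ∈ X then 1 else 0) - (if t.1 ∈ X then 1 else 0) : ℤ)).sum = 0 := hsum
  -- only `f` can contribute to the sum over the path in `T`
  have hstep : ∀ s ∈ w, ((if s.2.2 ∈ X then 1 else 0) - (if s.1 ∈ X then 1 else 0) : ℤ) = 0 ∨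
      (s = (H.tail f, f, H.head f) ∧
        ((if s.2.2 ∈ X then 1 else 0) - (if s.1 ∈ X then 1 else 0) : ℤ) = 1) ∨
      (s = (H.head f, f, H.tail f) ∧
        ((if s.2.2 ∈ X then 1 else 0) - (if s.1 ∈ X then 1 else 0) : ℤ) = -1) := by
    rintro ⟨x, i, y⟩ hs
    obtain ⟨hi, hl⟩ := hp.isLink _ hs
    dsimp only at hi hl
    by_cases hif : i = f
    · subst hif
      rcases hl with ⟨rfl, rfl⟩ | ⟨rfl, rfl⟩
      · exact Or.inr (Or.inl ⟨rfl, by simp [hX.head_mem, hX.tail_notMem]⟩)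
      · exact Or.inr (Or.inr ⟨rfl, by simp [hX.head_mem, hX.tail_notMem]⟩)
    · have := hX.mem_iff i hi hif
      rcases hl with ⟨rfl, rfl⟩ | ⟨rfl, rfl⟩ <;> left <;> simp [this]
  have hcut : H.cut X e = 0 ∨ H.cut X e = 1 ∨ H.cut X e = -1 := by
    rw [cut]; split_ifs <;> simp
  rw [cycleVector]
  rcases hcut with h | h | h
  · rw [if_neg, if_neg, h, neg_zero]
    · rintro ⟨w, h1, h2, h3⟩; have := key2 w h1 h2 h3; omega
    · rintro ⟨w, h1, h2, h3⟩; have := key1 w h1 h2 h3; omega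
  · rw [if_neg, if_pos, h]
    · refine ⟨_, hw, List.mem_cons_self, List.mem_cons_of_mem _ ?_⟩
      by_contra hn
      have : 0 ≤ (w.map fun t : V × E × V =>
          ((if t.2.2 ∈ X then 1 else 0) - (if t.1 ∈ X then 1 else 0) : ℤ)).sum := by
        refine List.sum_nonneg fun z hz => ?_
        obtain ⟨s, hs, rfl⟩ := List.mem_map.1 hz
        rcases hstep s hs with h | ⟨-, h⟩ | ⟨rfl, -⟩
        · exact h.ge
        · rw [h]; exact zero_le_one
        · exact absurd hs hn
      omega
    · rintro ⟨w, h1, h2, h3⟩; have := key1 w h1 h2 h3; omega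
  · rw [if_pos, h, neg_neg]
    refine ⟨_, hw, List.mem_cons_self, List.mem_cons_of_mem _ ?_⟩
    by_contra hn
    have : (w.map fun t : V × E × V =>
        ((if t.2.2 ∈ X then 1 else 0) - (if t.1 ∈ X then 1 else 0) : ℤ)).sum ≤ 0 := by
      refine (List.sum_le_card_nsmul _ 0 fun z hz => ?_).trans (smul_zero _).le
      obtain ⟨s, hs, rfl⟩ := List.mem_map.1 hz
      rcases hstep s hs with h | ⟨rfl, -⟩ | ⟨-, h⟩
      · exact h.le
      · exact absurd hs hn
      · rw [h]; norm_num
    omega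

end DirGraph

/-! ### The lattice spanned by the signed cycle--cocycle matrix -/

namespace DirGraph

variable {V E : Type*} {H : DirGraph V E} {T : Set E}

/-- The coboundary of an integer function of the vertices. -/
def coboundary (H : DirGraph V E) : (V → ℤ) →ₗ[ℤ] (E → ℤ) where
  toFun p i := p (H.head i) - p (H.tail i)
  map_add' p q := by ext i; simp only [Pi.add_apply]; ring
  map_smul' c p := by ext i; simp only [Pi.smul_apply, smul_eq_mul, RingHom.id_apply]; ring

theorem coboundary_apply (p : V → ℤ) (i : E) :
    H.coboundary p i = p (H.head i) - p (H.tail i) := rfl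

/-- The lattice of integer cuts. -/
def cutLattice (H : DirGraph V E) : Submodule ℤ (E → ℤ) := LinearMap.range H.coboundary

theorem cut_mem_cutLattice (X : Set V) : H.cut X ∈ H.cutLattice := by
  classical exact ⟨fun v => if v ∈ X then 1 else 0, by ext i; simp [coboundary_apply, cut]⟩

theorem eq_zero_of_mem_cutLattice (hT : IsSpanningTree H.toGraph T) {x : E → ℤ}
    (hx : x ∈ H.cutLattice) (h : ∀ f ∈ T, x f = 0) : x = 0 := by
  obtain ⟨p, rfl⟩ := hx
  have hp : ∀ u v, p u = p v := fun u v =>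
    JoinedBy.lift (r := fun u v => p u = p v) (fun _ => rfl) (fun _ _ _ h h' => h.trans h')
      (fun f hf u v hl => by
        have := sub_eq_zero.1 (h f hf)
        rcases hl with ⟨rfl, rfl⟩ | ⟨rfl, rfl⟩
        · exact this.symm
        · exact this) (joinedBy_of_isSpanningTree hT u v)
  ext i
  exact sub_eq_zero.2 (hp _ _)

theorem cycleCocycleMatrix_of_mem {f : E} (hf : f ∈ T) (i : E) :
    H.cycleCocycleMatrix T f i = H.cocycleVector T f i := by
  simp [cycleCocycleMatrix, hf]

theorem cycleCocycleMatrix_of_notMem {e : E} (he : e ∉ T) (i : E) :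
    H.cycleCocycleMatrix T e i = H.cycleVector T e i := by
  simp [cycleCocycleMatrix, he]

theorem cycleCocycleMatrix_row_mem_cutLattice (hT : IsSpanningTree H.toGraph T) {f : E}
    (hf : f ∈ T) : H.cycleCocycleMatrix T f ∈ H.cutLattice := by
  obtain ⟨X, hX⟩ := exists_isSide hT.isForest hf
  have : H.cycleCocycleMatrix T f = H.cut X := by
    ext i; rw [cycleCocycleMatrix_of_mem hf, hX.cocycleVector_eq hT hf]
  exact this ▸ cut_mem_cutLattice X

open Classical in
theorem cycleCocycleMatrix_apply_mem_mem (hT : IsSpanningTree H.toGraph T) {f i : E}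
    (hf : f ∈ T) (hi : i ∈ T) : H.cycleCocycleMatrix T f i = if i = f then 1 else 0 := by
  obtain ⟨X, hX⟩ := exists_isSide hT.isForest hf
  rw [cycleCocycleMatrix_of_mem hf, hX.cocycleVector_eq hT hf]
  split_ifs with h
  · rw [h, hX.cut_self]
  · exact cut_eq_zero (hX.mem_iff i hi h)

open Classical in
theorem cycleCocycleMatrix_apply_notMem_notMem (hT : IsSpanningTree H.toGraph T) {e i : E}
    (he : e ∉ T) (hi : i ∉ T) : H.cycleCocycleMatrix T e i = if i = e then 1 else 0 := by
  rw [cycleCocycleMatrix_of_notMem he]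
  split_ifs with h
  · rw [h, cycleVector_self hT he]
  · exact cycleVector_of_notMem hi h

theorem cycleCocycleMatrix_apply_notMem_mem (hT : IsSpanningTree H.toGraph T) {e f : E}
    (he : e ∉ T) (hf : f ∈ T) : H.cycleCocycleMatrix T e f = - H.cycleCocycleMatrix T f e := by
  obtain ⟨X, hX⟩ := exists_isSide hT.isForest hf
  rw [cycleCocycleMatrix_of_notMem he, cycleCocycleMatrix_of_mem hf, hX.cycleVector_eq hT hf he,
    hX.cocycleVector_eq hT hf]

/-- The change of the signs of some of the coordinates. -/
def signChange (s : E → ℤˣ) : (E → ℤ) ≃ₗ[ℤ] (E → ℤ) :=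
  LinearEquiv.piCongrRight fun i => LinearEquiv.smulOfUnit (s i)

theorem signChange_apply (s : E → ℤˣ) (x : E → ℤ) (i : E) : signChange s x i = s i * x i := rfl

theorem signChange_signChange (s : E → ℤˣ) (x : E → ℤ) : signChange s (signChange s x) = x := by
  ext i
  rw [signChange_apply, signChange_apply, ← mul_assoc, ← Units.val_mul, Int.units_mul_self,
    Units.val_one, one_mul]

theorem exists_signChange {H H' : DirGraph V E} (h : H.toGraph = H'.toGraph) :
    ∃ s : E → ℤˣ, ∀ p, H'.coboundary p = signChange s (H.coboundary p) := by
  classical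
  refine ⟨fun i => if H.tail i = H'.tail i ∧ H.head i = H'.head i then 1 else -1, fun p => ?_⟩
  ext i
  rw [signChange_apply, coboundary_apply, coboundary_apply]
  split_ifs with hi
  · rw [hi.1, hi.2]; simp
  · have hl := H.isLink_toGraph i
    rw [h] at hl
    rcases hl with hl | ⟨h1, h2⟩
    · exact absurd hl hi
    · rw [h1, h2]; simp

variable [Fintype E]

/-- The lattice of integer flows, as the orthogonal complement of the lattice of cuts. -/
def flowLattice (H : DirGraph V E) : Submodule ℤ (E → ℤ) where
  carrier := {x | ∀ y ∈ H.cutLattice, x ⬝ᵥ y = 0}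
  zero_mem' y _ := zero_dotProduct y
  add_mem' hx hx' y hy := by rw [add_dotProduct, hx y hy, hx' y hy, add_zero]
  smul_mem' c x hx y hy := by rw [smul_dotProduct, hx y hy, smul_zero]

open Classical in
/-- A cut is the combination of the fundamental cocycles whose coefficients are its values on the
spanning tree. -/
theorem eq_sum_of_mem_cutLattice (hT : IsSpanningTree H.toGraph T) {x : E → ℤ}
    (hx : x ∈ H.cutLattice) :
    x = ∑ f, (if f ∈ T then x f else 0) • H.cycleCocycleMatrix T f := by
  refine sub_eq_zero.1 (eq_zero_of_mem_cutLattice hT (H.cutLattice.sub_mem hx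
    (Submodule.sum_mem _ fun f _ => ?_)) fun i hi => ?_)
  · split_ifs with hf
    · exact H.cutLattice.smul_mem _ (cycleCocycleMatrix_row_mem_cutLattice hT hf)
    · rw [zero_smul]; exact H.cutLattice.zero_mem
  · rw [Pi.sub_apply, Finset.sum_apply, Finset.sum_eq_single i]
    · rw [if_pos hi, Pi.smul_apply, cycleCocycleMatrix_apply_mem_mem hT hi hi]; simp
    · intro f _ hfi
      rw [Pi.smul_apply]
      split_ifs with hf
      · rw [cycleCocycleMatrix_apply_mem_mem hT hf hi, if_neg hfi.symm, smul_zero]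
      · rw [zero_smul]
    · exact fun h => absurd (Finset.mem_univ i) h

theorem cycleCocycleMatrix_row_mem_flowLattice (hT : IsSpanningTree H.toGraph T) {e : E}
    (he : e ∉ T) : H.cycleCocycleMatrix T e ∈ H.flowLattice := by
  classical
  intro y hy
  rw [eq_sum_of_mem_cutLattice hT hy, dotProduct_sum]
  refine Finset.sum_eq_zero fun f _ => ?_
  rw [dotProduct_smul]
  split_ifs with hf
  · suffices H.cycleCocycleMatrix T e ⬝ᵥ H.cycleCocycleMatrix T f = 0 by rw [this, smul_zero]
    -- fundamental cycles and cocycles have at most the edges `e` and `f` in common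
    have hef : e ≠ f := fun h => he (h ▸ hf)
    rw [dotProduct, Finset.sum_eq_add_of_mem e f (Finset.mem_univ _) (Finset.mem_univ _) hef]
    · rw [cycleCocycleMatrix_apply_notMem_mem hT he hf,
        cycleCocycleMatrix_apply_mem_mem hT hf hf, cycleCocycleMatrix_apply_notMem_notMem hT he he]
      simp
    · rintro i - ⟨hie, hif⟩
      by_cases hi : i ∈ T
      · rw [cycleCocycleMatrix_apply_mem_mem hT hf hi, if_neg hif, mul_zero]
      · rw [cycleCocycleMatrix_apply_notMem_notMem hT he hi, if_neg hie, zero_mul]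
  · rw [zero_smul]

/-- The rows of the signed cycle--cocycle matrix span the sum of the lattices of flows and cuts,
whatever the spanning tree. -/
theorem span_range_row_cycleCocycleMatrix (hT : IsSpanningTree H.toGraph T) :
    Submodule.span ℤ (Set.range (H.cycleCocycleMatrix T).row) =
      H.cutLattice ⊔ H.flowLattice := by
  classical
  have hrow : ∀ e, H.cycleCocycleMatrix T e ∈
      Submodule.span ℤ (Set.range (H.cycleCocycleMatrix T).row) := fun e =>
    Submodule.subset_span ⟨e, rfl⟩
  refine le_antisymm (Submodule.span_le.2 ?_) (sup_le (fun x hx => ?_) fun x hx => ?_)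
  · rintro _ ⟨e, rfl⟩
    by_cases he : e ∈ T
    · exact Submodule.mem_sup_left (cycleCocycleMatrix_row_mem_cutLattice hT he)
    · exact Submodule.mem_sup_right (cycleCocycleMatrix_row_mem_flowLattice hT he)
  · rw [eq_sum_of_mem_cutLattice hT hx]
    exact Submodule.sum_mem _ fun f _ => Submodule.smul_mem _ _ (hrow f)
  · suffices x = ∑ e, (if e ∈ T then 0 else x e) • H.cycleCocycleMatrix T e by
      rw [this]
      exact Submodule.sum_mem _ fun f _ => Submodule.smul_mem _ _ (hrow f)
    set z := x - ∑ e, (if e ∈ T then 0 else x e) • H.cycleCocycleMatrix T e with hz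
    have hzf : z ∈ H.flowLattice := by
      refine H.flowLattice.sub_mem hx (Submodule.sum_mem _ fun e _ => ?_)
      split_ifs with he
      · rw [zero_smul]; exact H.flowLattice.zero_mem
      · exact H.flowLattice.smul_mem _ (cycleCocycleMatrix_row_mem_flowLattice hT he)
    have hz0 : ∀ i ∉ T, z i = 0 := by
      intro i hi
      rw [hz, Pi.sub_apply, Finset.sum_apply, Finset.sum_eq_single i]
      · rw [if_neg hi, Pi.smul_apply, cycleCocycleMatrix_apply_notMem_notMem hT hi hi]; simp
      · intro e _ hei
        rw [Pi.smul_apply]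
        split_ifs with he
        · rw [zero_smul]
        · rw [cycleCocycleMatrix_apply_notMem_notMem hT he hi, if_neg hei.symm, smul_zero]
      · exact fun h => absurd (Finset.mem_univ i) h
    refine sub_eq_zero.1 (funext fun i => ?_)
    by_cases hi : i ∈ T
    · have h := hzf _ (cycleCocycleMatrix_row_mem_cutLattice hT hi)
      rw [dotProduct, Finset.sum_eq_single i] at h
      · rwa [cycleCocycleMatrix_apply_mem_mem hT hi hi, if_pos rfl, mul_one] at h
      · intro j _ hji
        by_cases hj : j ∈ T
        · rw [cycleCocycleMatrix_apply_mem_mem hT hi hj, if_neg hji, mul_zero]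
        · rw [hz0 j hj, zero_mul]
      · exact fun h => absurd (Finset.mem_univ i) h
    · exact hz0 i hi

theorem signChange_dotProduct (s : E → ℤˣ) (x y : E → ℤ) :
    signChange s x ⬝ᵥ y = x ⬝ᵥ signChange s y :=
  Finset.sum_congr rfl fun i _ => by rw [signChange_apply, signChange_apply]; ring

theorem map_signChange_le {H H' : DirGraph V E} {s : E → ℤˣ}
    (h : ∀ p, H'.coboundary p = signChange s (H.coboundary p)) :
    (H.cutLattice ⊔ H.flowLattice).map (signChange s).toLinearMap ≤
      H'.cutLattice ⊔ H'.flowLattice := by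
  rw [Submodule.map_sup]
  refine sup_le_sup ?_ ?_
  · rintro _ ⟨_, ⟨p, rfl⟩, rfl⟩
    exact ⟨p, h p⟩
  · rintro _ ⟨x, hx, rfl⟩ _ ⟨p, rfl⟩
    rw [h, LinearEquiv.coe_coe, signChange_dotProduct, signChange_signChange]
    exact hx _ ⟨p, rfl⟩

/-- The cokernel of the signed cycle--cocycle matrix depends only on the undirected graph. -/
theorem nonempty_coker_equiv {H H' : DirGraph V E} {T T' : Set E} (h : H.toGraph = H'.toGraph)
    (hT : IsSpanningTree H.toGraph T) (hT' : IsSpanningTree H'.toGraph T') :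
    Nonempty (Coker (H.cycleCocycleMatrix T) ≃+ Coker (H'.cycleCocycleMatrix T')) := by
  obtain ⟨s, hs⟩ := exists_signChange h
  refine ⟨(Submodule.Quotient.equiv _ _ (signChange s) ?_).toAddEquiv⟩
  rw [span_range_row_cycleCocycleMatrix hT, span_range_row_cycleCocycleMatrix hT']
  refine le_antisymm (map_signChange_le hs) fun x hx => ?_
  have hs' : ∀ p, H.coboundary p = signChange s (H'.coboundary p) := fun p => by
    rw [hs, signChange_signChange]
  exact ⟨signChange s x, map_signChange_le hs' ⟨x, hx, rfl⟩, signChange_signChange s x⟩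

end DirGraph

/-! ### Spanning quasi-trees and the cyclicity of `α^T σ` -/

section Keep

variable {D : Type*} [Finite D]

theorem sameCycle_keep_iff {β : Equiv.Perm D} {S : Set D} (x y : S) :
    (keep β S).SameCycle x y ↔ β.SameCycle (x : D) y := by
  constructor
  · refine fun h => mem_of_sameCycle (S := {z : S | β.SameCycle x z}) (fun z hz => ?_) h
      (SameCycle.refl _ _)
    obtain ⟨k, -, hk, -⟩ := exists_keep_eq β S z
    change β.SameCycle x (keep β S z)
    rw [hk]
    exact sameCycle_pow_right.2 hz
  · intro h
    obtain ⟨n, hn⟩ := h.exists_nat_pow_eq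
    clear h
    induction n using Nat.strong_induction_on generalizing x with
    | _ n ih =>
      rcases Nat.eq_zero_or_pos n with rfl | hn0
      · rw [Subtype.ext hn]
      obtain ⟨k, hk0, hk, hk'⟩ := exists_keep_eq β S x
      have hkn : k ≤ n := not_lt.1 fun hlt => hk' n hn0 hlt (hn ▸ y.2)
      refine sameCycle_apply_left.1 (ih (n - k) (by omega) (keep β S x) ?_)
      rw [hk, ← mul_apply, ← pow_add, Nat.sub_add_cancel hkn, hn]

theorem numCycles_keep_eq_iff {β : Equiv.Perm D} {S : Set D} (hS : S.Nonempty) :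
    numCycles (keep β S) = numCycles β ↔ ∀ d, ∃ x ∈ S, β.SameCycle d x := by
  have : Nonempty S := hS.to_subtype
  have : Nonempty D := ⟨hS.some⟩
  rw [numCycles_eq_card, numCycles_eq_card]
  let F : Quotient (SameCycle.setoid (keep β S)) → Quotient (SameCycle.setoid β) :=
    Quotient.map' Subtype.val fun x y h => (sameCycle_keep_iff x y).1 h
  have hF : Function.Injective F := by
    intro p q
    induction p, q using Quotient.inductionOn₂ with
    | h x y =>
      intro h
      exact Quotient.sound ((sameCycle_keep_iff x y).2
        (Quotient.exact (s := SameCycle.setoid β) h))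
  constructor
  · intro h d
    obtain ⟨q, hq⟩ := ((Nat.bijective_iff_injective_and_card F).2 ⟨hF, h⟩).2 (Quotient.mk _ d)
    induction q using Quotient.inductionOn with
    | h x => exact ⟨x, x.2, SameCycle.symm (Quotient.exact (s := SameCycle.setoid β) hq)⟩
  · intro h
    refine Nat.card_congr (Equiv.ofBijective F ⟨hF, fun q => ?_⟩)
    induction q using Quotient.inductionOn with
    | h d =>
      obtain ⟨x, hx, hdx⟩ := h d
      exact ⟨Quotient.mk _ ⟨x, hx⟩, Quotient.sound (SameCycle.symm hdx)⟩

/-- If two permutations agree as long as they stay outside `S`, and all cycles of one meet `S`,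
then so do those of the other. -/
theorem forall_exists_sameCycle_of_eqOn {β γ : Equiv.Perm D} {S : Set D}
    (h : ∀ z, β z ∉ S → γ z = β z) (hγ : ∀ d, ∃ x ∈ S, γ.SameCycle d x) (d : D) :
    ∃ x ∈ S, β.SameCycle d x := by
  by_contra! hn
  obtain ⟨x, hx, hdx⟩ := hγ d
  refine hn x hx (mem_of_sameCycle (S := {z | β.SameCycle d z}) (fun z hz => ?_) hdx
    (SameCycle.refl _ _))
  have hz' : β.SameCycle d (β z) := sameCycle_apply_right.2 hz
  rw [h z fun hS => hn _ hS hz']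
  exact hz'

theorem keepsTo_rotate {β : Equiv.Perm D} {a b c d : D} :
    KeepsTo β a b c d ↔ KeepsTo β b c d a := by
  have hS : ({a, b, c, d} : Set D) = {b, c, d, a} := by ext x; simp; tauto
  have h : ∀ {S S' : Set D} (_ : S = S') (x : D) (hx : x ∈ S) (hx' : x ∈ S'),
      (keep β S ⟨x, hx⟩ : D) = keep β S' ⟨x, hx'⟩ := by
    rintro S _ rfl x _ _; rfl
  rw [KeepsTo, KeepsTo, h hS a _ (by simp), h hS b _ (by simp), h hS c _ (by simp),
    h hS d _ (by simp)]
  tauto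

end Keep

namespace CombMap

variable {D : Type*} (G : CombMap D)

theorem vertexOf_eq_iff (x y : D) : G.vertexOf x = G.vertexOf y ↔ G.σ.SameCycle x y :=
  ⟨fun h => Quotient.exact (s := SameCycle.setoid G.σ) (Sum.inl.inj h),
    fun h => congrArg Sum.inl (Quotient.sound h)⟩

theorem vertexOf_σ (x : D) : G.vertexOf (G.σ x) = G.vertexOf x :=
  (G.vertexOf_eq_iff _ _).2 (sameCycle_apply_left.2 (SameCycle.refl _ _))

theorem exists_vertexOf [Nonempty D] (v : G.Vertex) : ∃ d, G.vertexOf d = v := by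
  rcases v with q | h
  · induction q using Quotient.inductionOn with
    | h d => exact ⟨d, rfl⟩
  · exact (h.down.false (Classical.arbitrary D)).elim

theorem subsingleton_vertex [IsEmpty D] : Subsingleton G.Vertex :=
  ((Nat.card_eq_one_iff_unique).1 (numCycles_of_isEmpty G.σ)).1

theorem nonempty_vertex : Nonempty G.Vertex := by
  rcases isEmpty_or_nonempty D with hD | ⟨⟨d⟩⟩
  · exact ((Nat.card_eq_one_iff_unique).1 (numCycles_of_isEmpty G.σ)).2
  · exact ⟨G.vertexOf d⟩

/-- To join any two vertices by walks it is enough to join the vertices of any two darts. -/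
theorem joinedBy_of_forall_vertexOf {F : Set G.Edge}
    (h : ∀ x y, JoinedBy G.graph F (G.vertexOf x) (G.vertexOf y)) (u v : G.Vertex) :
    JoinedBy G.graph F u v := by
  rcases isEmpty_or_nonempty D with hD | hD
  · have := G.subsingleton_vertex
    rw [Subsingleton.elim u v]
    exact Relation.ReflTransGen.refl
  · obtain ⟨x, rfl⟩ := G.exists_vertexOf u
    obtain ⟨y, rfl⟩ := G.exists_vertexOf v
    exact h x y

theorem isLink_graph (d : D) :
    G.graph.IsLink (G.edgeOf d) (G.vertexOf d) (G.vertexOf (G.α d)) := ⟨d, rfl, rfl, rfl⟩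

variable {G}

theorem IsConnected.joinedBy (h : G.IsConnected) (u v : G.Vertex) :
    JoinedBy G.graph E(G.graph) u v := by
  by_contra hn
  obtain ⟨d, h1, h2⟩ := h {w | JoinedBy G.graph E(G.graph) u w}
    {w | JoinedBy G.graph E(G.graph) u w}ᶜ ⟨u, Relation.ReflTransGen.refl⟩ ⟨v, hn⟩
    disjoint_compl_right (Set.union_compl_self _)
  exact h2 (JoinedBy.trans h1 (JoinedBy.of_isLink (G.isLink_graph d) trivial))

theorem exists_isSpanningTree_graph [Finite D] (h : G.IsConnected) :
    ∃ T, IsSpanningTree G.graph T :=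
  exists_isSpanningTree ⟨G.nonempty_vertex.some, trivial⟩ fun x _ y _ => h.joinedBy x y

/-- The darts of a cycle of `α^T σ` belong to vertices joined by edges of `T`. -/
theorem joinedBy_of_sameCycle [Finite D] {T : Set G.Edge} {x y : D}
    (h : (G.αOn T * G.σ).SameCycle x y) : JoinedBy G.graph T (G.vertexOf x) (G.vertexOf y) := by
  refine mem_of_sameCycle (S := {z | JoinedBy G.graph T (G.vertexOf x) (G.vertexOf z)})
    (fun z hz => JoinedBy.trans hz ?_) h Relation.ReflTransGen.refl
  rw [mul_apply]
  by_cases hT : G.edgeOf (G.σ z) ∈ T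
  · rw [αOn_apply_of_mem G hT, ← G.vertexOf_σ z]
    exact JoinedBy.of_isLink (G.isLink_graph _) hT
  · rw [αOn_apply_of_notMem G hT, G.vertexOf_σ]
    exact Relation.ReflTransGen.refl

/-- If `T` is a forest, the darts of the vertices of each of its components form a single cycle of
`α^T σ`: each edge of `T` merges the cycles of the two components that it joins. -/
theorem sameCycle_of_joinedBy [Finite D] {T : Set G.Edge} (hT : IsForest G.graph T) :
    ∀ {x y : D}, JoinedBy G.graph T (G.vertexOf x) (G.vertexOf y) →
      (G.αOn T * G.σ).SameCycle x y := by
  classical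
  induction T, T.toFinite using Set.Finite.induction_on with
  | empty =>
    intro x y h
    rw [αOn_empty, one_mul, ← vertexOf_eq_iff]
    exact JoinedBy.lift (fun _ => rfl) (fun _ _ _ => Eq.trans) (fun e he => he.elim) h
  | @insert e U he _ ih =>
    intro x y h
    replace ih := @ih (hT.mono (Set.subset_insert e U))
    obtain ⟨d, rfl⟩ := G.exists_edgeOf e
    have hsep : ¬ (G.αOn U * G.σ).SameCycle d (G.α d) := by
      intro hs
      refine hT _ (Set.mem_insert _ _) _ _ (G.isLink_graph d) ?_
      rw [Set.insert_sdiff_self_of_notMem he]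
      exact joinedBy_of_sameCycle hs
    have hmul : G.αOn (insert (G.edgeOf d) U) * G.σ =
        Equiv.swap d (G.α d) * (G.αOn U * G.σ) := by
      rw [Set.insert_eq, αOn_union G (Set.disjoint_singleton_left.2 he), αOn_singleton, mul_assoc]
    rw [hmul]
    have hd := sameCycle_swap_mul hsep
    have ih' : ∀ {x y : D}, JoinedBy G.graph U (G.vertexOf x) (G.vertexOf y) →
        (Equiv.swap d (G.α d) * (G.αOn U * G.σ)).SameCycle x y := fun hxy =>
      SameCycle.mono (sameCycle_swap_mul_apply hd) (ih hxy)
    have ih0 : ∀ {x y : D}, G.vertexOf x = G.vertexOf y →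
        (Equiv.swap d (G.α d) * (G.αOn U * G.σ)).SameCycle x y := fun hxy =>
      ih' (hxy ▸ Relation.ReflTransGen.refl)
    refine JoinedBy.lift (r := fun u v => ∀ x y, G.vertexOf x = u → G.vertexOf y = v →
      (Equiv.swap d (G.α d) * (G.αOn U * G.σ)).SameCycle x y) ?_ ?_ ?_ h x y rfl rfl
    · rintro _ x y rfl h
      exact ih0 h.symm
    · intro u v w huv hvw x y hx hy
      have : Nonempty D := ⟨x⟩
      obtain ⟨z, hz⟩ := G.exists_vertexOf v
      exact (huv x z hx hz).trans (hvw z y hz hy)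
    · rintro e' he' _ _ ⟨a, rfl, rfl, rfl⟩ x y hx hy
      rcases he' with he' | he'
      · have ha : (Equiv.swap d (G.α d) * (G.αOn U * G.σ)).SameCycle a (G.α a) := by
          rcases (G.edgeOf_eq_iff _ _).1 he' with h' | h'
          · exact h' ▸ hd
          · rw [show a = G.α d by rw [h', G.α_invol], G.α_invol]
            exact hd.symm
        exact ((ih0 hx).trans ha).trans (ih0 hy.symm)
      · exact ih' (hx ▸ hy ▸ JoinedBy.of_isLink (G.isLink_graph a) he')

theorem isCyclic_of_isSpanningTree [Finite D] {T : Set G.Edge} (hT : IsSpanningTree G.graph T) :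
    IsCyclic (G.αOn T * G.σ) :=
  (isCyclic_iff _).2 fun _ _ =>
    sameCycle_of_joinedBy hT.isForest (hT.connected.2 _ trivial _ trivial)

theorem keep_αOn_mul_σ [Finite D] (T : Set G.Edge) :
    keep (G.αOn T * G.σ) {d | G.edgeOf d ∈ T} =
      (G.inducedSubmap T).α * (G.inducedSubmap T).σ := by
  ext x
  obtain ⟨k, hk0, hk, hk'⟩ := exists_keep_eq G.σ {d | G.edgeOf d ∈ T} x
  have hτ : ∀ j < k, ((G.αOn T * G.σ) ^ j) (x : D) = (G.σ ^ j) x := by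
    intro j
    induction j with
    | zero => exact fun _ => rfl
    | succ j ih =>
      intro hj
      rw [pow_succ', mul_apply, ih (by omega), mul_apply, ← mul_apply G.σ, ← pow_succ']
      exact αOn_apply_of_notMem G (hk' _ j.succ_pos hj)
  have hτk : ((G.αOn T * G.σ) ^ k) (x : D) = G.α (keep G.σ {d | G.edgeOf d ∈ T} x) := by
    obtain ⟨k, rfl⟩ := Nat.exists_eq_succ_of_ne_zero hk0.ne'
    rw [Nat.succ_eq_add_one] at *
    rw [pow_succ', mul_apply, hτ k (by omega), mul_apply, ← mul_apply G.σ, ← pow_succ', ← hk]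
    exact αOn_apply_of_mem G (keep G.σ {d | G.edgeOf d ∈ T} x).2
  rw [keep_eq_of_forall_notMem hk0, hτk]
  · rfl
  · rw [hτk]
    exact (congrArg (· ∈ T) (G.edgeOf_α _)).mpr (keep G.σ {d | G.edgeOf d ∈ T} x).2
  · intro j hj0 hjk
    rw [hτ j hjk]
    exact hk' j hj0 hjk

/-- The boundary of the face of `G[T]` is `α^T σ` without the darts of the edges outside `T`, so
`T` is the edge set of a spanning quasi-tree if and only if `α^T σ` is cyclic. -/
theorem isSpanningQuasiTree_iff [Finite D] {T : Set G.Edge} :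
    G.IsSpanningQuasiTree T ↔ IsCyclic (G.αOn T * G.σ) := by
  set S : Set D := {d | G.edgeOf d ∈ T} with hSdef
  rcases S.eq_empty_or_nonempty with hS | hS
  · have hempty : IsEmpty S := Set.isEmpty_coe_sort.2 hS
    have h1 : G.αOn T = 1 := Equiv.ext fun d =>
      αOn_apply_of_notMem G fun hd => Set.eq_empty_iff_forall_notMem.1 hS d hd
    have h2 : ∀ β : Equiv.Perm {d : D | G.edgeOf d ∈ T}, numCycles β = 1 :=
      @numCycles_of_isEmpty _ hempty
    rw [h1, one_mul, IsSpanningQuasiTree, IsQuasiTree, IsCyclic, IsCyclic, h2, h2]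
    exact ⟨fun h => h.2.symm, fun h => ⟨rfl, h.symm⟩⟩
  · have h1 : (G.inducedSubmap T).IsQuasiTree ↔
        ∀ x y : S, (G.αOn T * G.σ).SameCycle (x : D) y := by
      have hφ : (G.inducedSubmap T).φ = (keep (G.αOn T * G.σ) S)⁻¹ := by
        rw [keep_αOn_mul_σ, mul_inv_rev, (G.inducedSubmap T).φ_eq]
      rw [IsQuasiTree, isCyclic_iff, hφ]
      exact forall₂_congr fun x y => sameCycle_inv.trans (sameCycle_keep_iff x y)
    have h2 : numCycles (G.inducedSubmap T).σ = numCycles G.σ ↔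
        ∀ d, ∃ x ∈ S, (G.αOn T * G.σ).SameCycle d x := by
      refine (numCycles_keep_eq_iff hS).trans ⟨forall_exists_sameCycle_of_eqOn fun z hz => ?_,
        forall_exists_sameCycle_of_eqOn fun z hz => ?_⟩
      · have : G.edgeOf (G.σ z) ∉ T := fun h => hz (by
          rwa [hSdef, Set.mem_ofPred_eq, mul_apply, edgeOf_αOn])
        exact (αOn_apply_of_notMem G this).symm
      · exact αOn_apply_of_notMem G hz
    rw [IsSpanningQuasiTree, h1, h2, isCyclic_iff]
    constructor
    · rintro ⟨h3, h4⟩ x y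
      obtain ⟨x', hx', hx⟩ := h4 x
      obtain ⟨y', hy', hy⟩ := h4 y
      exact (hx.trans (h3 ⟨x', hx'⟩ ⟨y', hy'⟩)).trans hy.symm
    · exact fun h => ⟨fun x y => h x y, fun d => ⟨_, hS.some_mem, h _ _⟩⟩

end CombMap

/-! ### Plane maps -/

namespace CombMap

variable {D : Type*} {G : CombMap D} {T : Set G.Edge}

theorem αOn_mul_αOn_mul_σ : G.αOn T * (G.αOn T * G.σ) = G.σ := by
  rw [← mul_assoc, αOn_mul_self, one_mul]

theorem αOn_compl_mul_αOn_mul_σ : G.αOn Tᶜ * (G.αOn T * G.σ) = G.φ⁻¹ := by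
  rw [← mul_assoc, ← αOn_union G disjoint_compl_left, Set.compl_union_self, αOn_univ, G.φ_eq,
    mul_inv_rev, inv_inv, inv_inv]

/-- In a plane map with `α^T σ` cyclic, the vertices and the faces are as many as a product of a
cyclic permutation with the transpositions of the edges of `T`, respectively of its complement,
allows: both bounds are sharp because their sum is, by Euler's formula. -/
theorem IsPlane.ncard_add_one_le [Finite D] (hG : G.IsPlane) (hT : IsCyclic (G.αOn T * G.σ)) :
    T.ncard + 1 ≤ numCycles (G.αOn T * (G.αOn T * G.σ)) ∧
      Tᶜ.ncard + 1 ≤ numCycles (G.αOn Tᶜ * (G.αOn T * G.σ)) := by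
  have h1 := numCycles_αOn_mul_le G T (G.αOn T * G.σ)
  have h2 := numCycles_αOn_mul_le G Tᶜ (G.αOn T * G.σ)
  have h3 : T.ncard + Tᶜ.ncard = Nat.card G.Edge := Set.ncard_add_ncard_compl T
  have h4 : numCycles G.σ + numCycles G.φ = Nat.card G.Edge + 2 := by
    have := hG.2
    rw [genus, div_eq_zero_iff, or_iff_left two_ne_zero] at this
    have h : (numCycles G.σ : ℚ) + numCycles G.φ = Nat.card G.Edge + 2 := by linarith
    exact_mod_cast h
  rw [αOn_mul_αOn_mul_σ] at h1 ⊢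
  rw [αOn_compl_mul_αOn_mul_σ, numCycles_inv] at h2 ⊢
  rw [IsCyclic] at hT
  omega

end CombMap

namespace DirectedMap

variable {D : Type*} {G : DirectedMap D} {T : Set G.Edge}

theorem edgeOf_neg (e : G.Edge) : G.edgeOf (G.neg e) = e :=
  (G.edgeOf_α _).trans (G.edgeOf_pos e)

theorem α_neg (e : G.Edge) : G.α (G.neg e) = G.pos e := G.α_invol _

theorem pos_ne_neg (e : G.Edge) : G.pos e ≠ G.neg e := (G.α_fixedPointFree _).symm

theorem ne_of_edgeOf_ne {x y : D} {e i : G.Edge} (hei : e ≠ i) (hx : G.edgeOf x = e)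
    (hy : G.edgeOf y = i) : x ≠ y := fun h => hei (hx.symm.trans ((congrArg _ h).trans hy))

/-- The darts met by the cyclic permutation `α^T σ` from the head to the tail of an edge. -/
def arcOf (G : DirectedMap D) (T : Set G.Edge) (e : G.Edge) : Set D :=
  arc (G.αOn T * G.σ) (G.pos e) (G.neg e)

theorem pos_mem_arcOf (e : G.Edge) : G.pos e ∈ G.arcOf T e := left_mem_arc (pos_ne_neg e)

theorem neg_notMem_arcOf (e : G.Edge) : G.neg e ∉ G.arcOf T e := right_notMem_arc

/-- The vertices of the darts met by `α^T σ` from the head to the tail of the edge `e`. -/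
def sideOf (G : DirectedMap D) (T : Set G.Edge) (e : G.Edge) : Set G.Vertex :=
  G.vertexOf '' G.arcOf T e

variable [Finite D]

theorem α_mem_arcOf {U : Set G.Edge} (hT : IsCyclic (G.αOn T * G.σ))
    (hU : U.ncard + 1 ≤ numCycles (G.αOn U * (G.αOn T * G.σ))) {e : G.Edge} {d : D}
    (he : e ∈ U) (hd : G.edgeOf d ∈ U) (hne : G.edgeOf d ≠ e) (h : d ∈ G.arcOf T e) :
    G.α d ∈ G.arcOf T e :=
  G.α_mem_arc_of_le_numCycles hT hU (by rwa [G.edgeOf_pos]) hd (by rwa [G.edgeOf_pos]) h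

theorem pos_mem_arcOf_iff {U : Set G.Edge} (hT : IsCyclic (G.αOn T * G.σ))
    (hU : U.ncard + 1 ≤ numCycles (G.αOn U * (G.αOn T * G.σ))) {e i : G.Edge}
    (he : e ∈ U) (hi : i ∈ U) (hne : i ≠ e) : G.pos i ∈ G.arcOf T e ↔ G.neg i ∈ G.arcOf T e := by
  constructor
  · exact α_mem_arcOf hT hU he (by rwa [G.edgeOf_pos]) (by rwa [G.edgeOf_pos])
  · intro h
    rw [← α_neg i]
    exact α_mem_arcOf hT hU he (by rwa [edgeOf_neg]) (by rwa [edgeOf_neg]) h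

theorem keepsTo_pos_iff (hT : IsCyclic (G.αOn T * G.σ)) {e i : G.Edge} (hei : e ≠ i) :
    KeepsTo (G.αOn T * G.σ) (G.pos e) (G.pos i) (G.neg e) (G.neg i) ↔
      G.pos i ∈ G.arcOf T e ∧ G.neg i ∉ G.arcOf T e :=
  keepsTo_iff ((isCyclic_iff _).1 hT) (ne_of_edgeOf_ne hei (G.edgeOf_pos e) (G.edgeOf_pos i))
    (pos_ne_neg e) (ne_of_edgeOf_ne hei (G.edgeOf_pos e) (edgeOf_neg i))
    (ne_of_edgeOf_ne hei.symm (G.edgeOf_pos i) (edgeOf_neg e)) (pos_ne_neg i)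
    (ne_of_edgeOf_ne hei (edgeOf_neg e) (edgeOf_neg i))

theorem keepsTo_pos_iff' (hT : IsCyclic (G.αOn T * G.σ)) {e i : G.Edge} (hei : e ≠ i) :
    KeepsTo (G.αOn T * G.σ) (G.pos i) (G.pos e) (G.neg i) (G.neg e) ↔
      G.neg i ∈ G.arcOf T e ∧ G.pos i ∉ G.arcOf T e :=
  keepsTo_rotate.trans <|
  keepsTo_iff ((isCyclic_iff _).1 hT) (ne_of_edgeOf_ne hei (G.edgeOf_pos e) (edgeOf_neg i))
    (pos_ne_neg e) (ne_of_edgeOf_ne hei (G.edgeOf_pos e) (G.edgeOf_pos i))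
    (ne_of_edgeOf_ne hei.symm (edgeOf_neg i) (edgeOf_neg e)) (pos_ne_neg i).symm
    (ne_of_edgeOf_ne hei (edgeOf_neg e) (G.edgeOf_pos i))

open Classical in
theorem matrixA_apply (hT : IsCyclic (G.αOn T * G.σ)) {e i : G.Edge} (hei : e ≠ i) :
    G.matrixA T e i =
      (if G.pos i ∈ G.arcOf T e then 1 else 0) - if G.neg i ∈ G.arcOf T e then 1 else 0 := by
  rw [matrixA, Matrix.of_apply, keepsTo_pos_iff hT hei, keepsTo_pos_iff' hT hei]
  by_cases h1 : G.pos i ∈ G.arcOf T e <;> by_cases h2 : G.neg i ∈ G.arcOf T e <;> simp [h1, h2]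

theorem matrixA_apply_swap (hT : IsCyclic (G.αOn T * G.σ)) {e i : G.Edge} (hei : e ≠ i) :
    G.matrixA T e i = - G.matrixA T i e := by
  have h : ¬ (KeepsTo (G.αOn T * G.σ) (G.pos e) (G.pos i) (G.neg e) (G.neg i) ∧
      KeepsTo (G.αOn T * G.σ) (G.pos i) (G.pos e) (G.neg i) (G.neg e)) := by
    rw [keepsTo_pos_iff hT hei, keepsTo_pos_iff' hT hei]
    tauto
  simp only [matrixA, Matrix.of_apply]
  split_ifs <;> simp_all

theorem matrixA_apply_self (e : G.Edge) :
    G.matrixA T e e = 0 := by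
  have h : ¬ KeepsTo (G.αOn T * G.σ) (G.pos e) (G.pos e) (G.neg e) (G.neg e) := fun h =>
    pos_ne_neg e (h.1.symm.trans h.2.1)
  rw [matrixA, Matrix.of_apply, if_neg h, if_neg h]

/-- As the edges of `T` do not cross, an arc between the ends of an edge of `T` consists of all
the darts of some vertices. -/
theorem vertexOf_mem_sideOf_iff (hG : G.IsPlane) (hT : IsCyclic (G.αOn T * G.σ)) {f : G.Edge}
    (hf : f ∈ T) {d : D} : G.vertexOf d ∈ G.sideOf T f ↔ d ∈ G.arcOf T f := by
  classical
  refine ⟨?_, fun h => ⟨d, h, rfl⟩⟩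
  rintro ⟨x, hx, hxd⟩
  refine mem_of_sameCycle (fun z hz => ?_) ((G.vertexOf_eq_iff _ _).1 hxd) hx
  have h1 : (G.αOn {f} * (G.αOn T * G.σ)) z ∈ G.arcOf T f := by
    have := swap_mul_apply_mem_arc ((isCyclic_iff _).1 hT (G.pos f) (G.neg f)) (pos_ne_neg f) hz
    have hswap : G.αOn {f} = Equiv.swap (G.pos f) (G.neg f) := by
      conv_lhs => rw [← G.edgeOf_pos f]
      exact G.αOn_singleton _
    rwa [hswap]
  have h2 : G.σ = G.αOn (T \ {f}) * (G.αOn {f} * (G.αOn T * G.σ)) := by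
    rw [← mul_assoc, ← CombMap.αOn_union _ Set.disjoint_sdiff_left, Set.sdiff_union_self,
      Set.union_eq_left.2 (Set.singleton_subset_iff.2 hf), CombMap.αOn_mul_αOn_mul_σ]
  rw [h2, mul_apply]
  set y := (G.αOn {f} * (G.αOn T * G.σ)) z
  by_cases hy : G.edgeOf y ∈ T \ {f}
  · rw [CombMap.αOn_apply_of_mem _ hy]
    exact α_mem_arcOf hT (hG.ncard_add_one_le hT).1 hf hy.1 hy.2 h1
  · rwa [CombMap.αOn_apply_of_notMem _ hy]

theorem isSide_sideOf (hG : G.IsPlane) (hT : IsCyclic (G.αOn T * G.σ)) {f : G.Edge}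
    (hf : f ∈ T) : G.dirGraph.IsSide T f (G.sideOf T f) where
  head_mem := (vertexOf_mem_sideOf_iff hG hT hf).2 (pos_mem_arcOf f)
  tail_notMem h := neg_notMem_arcOf f ((vertexOf_mem_sideOf_iff hG hT hf).1 h)
  mem_iff i hi hif := by
    refine (vertexOf_mem_sideOf_iff hG hT hf).trans (Iff.trans ?_
      (vertexOf_mem_sideOf_iff hG hT hf).symm)
    exact pos_mem_arcOf_iff hT (hG.ncard_add_one_le hT).1 hf hi hif

open Classical in
theorem cut_sideOf (hG : G.IsPlane) (hT : IsCyclic (G.αOn T * G.σ)) {f : G.Edge}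
    (hf : f ∈ T) (i : G.Edge) : G.dirGraph.cut (G.sideOf T f) i =
      (if G.pos i ∈ G.arcOf T f then 1 else 0) - if G.neg i ∈ G.arcOf T f then 1 else 0 := by
  rw [← vertexOf_mem_sideOf_iff hG hT hf, ← vertexOf_mem_sideOf_iff hG hT hf]
  rfl

/-- In a plane map a spanning quasi-tree is a spanning tree. -/
theorem isSpanningTree_of_isCyclic (hG : G.IsPlane) (hT : IsCyclic (G.αOn T * G.σ)) :
    IsSpanningTree G.dirGraph.toGraph T := by
  refine isSpanningTree_of_isForest (Set.subset_univ T) ⟨G.nonempty_vertex.some, trivial⟩ ?_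
    (DirGraph.isForest_of_isSide fun f hf => ⟨_, isSide_sideOf hG hT hf⟩)
  rw [G.toGraph_dirGraph]
  exact fun u _ v _ => G.joinedBy_of_forall_vertexOf
    (fun x y => CombMap.joinedBy_of_sameCycle ((isCyclic_iff _).1 hT x y)) u v

theorem cycleCocycleMatrix_eq (hG : G.IsPlane) (hT : IsCyclic (G.αOn T * G.σ)) :
    G.dirGraph.cycleCocycleMatrix T = G.matrixA T + 1 := by
  have htree := isSpanningTree_of_isCyclic hG hT
  ext e i
  rw [Matrix.add_apply]
  rcases eq_or_ne e i with rfl | hei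
  · rw [matrixA_apply_self, Matrix.one_apply_eq, zero_add]
    by_cases he : e ∈ T
    · rw [DirGraph.cycleCocycleMatrix_apply_mem_mem htree he he, if_pos rfl]
    · rw [DirGraph.cycleCocycleMatrix_apply_notMem_notMem htree he he, if_pos rfl]
  · rw [Matrix.one_apply_ne hei, add_zero]
    have hmem : ∀ {f j : G.Edge}, f ∈ T → f ≠ j →
        G.dirGraph.cycleCocycleMatrix T f j = G.matrixA T f j := fun {f j} hf hfj => by
      rw [DirGraph.cycleCocycleMatrix_of_mem hf,
        (isSide_sideOf hG hT hf).cocycleVector_eq htree hf, cut_sideOf hG hT hf,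
        matrixA_apply hT hfj]
    by_cases he : e ∈ T
    · exact hmem he hei
    · by_cases hi : i ∈ T
      · rw [DirGraph.cycleCocycleMatrix_apply_notMem_mem htree he hi, hmem hi hei.symm,
          matrixA_apply_swap hT hei]
      · rw [DirGraph.cycleCocycleMatrix_apply_notMem_notMem htree he hi, if_neg hei.symm,
          matrixA_apply hT hei]
        have h := pos_mem_arcOf_iff hT (hG.ncard_add_one_le hT).2 he hi hei.symm
        by_cases hn : G.neg i ∈ G.arcOf T e <;> simp [h, hn]

end DirectedMap

end MapCritical

end

theorem theorem5p2 {D : Type*} [Finite D] (G : MapCritical.DirectedMap D) (hG : G.IsPlane) :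
    -- for every spanning tree `T` of the underlying abstract directed graph,
    -- `A(G,T)` is defined and `A(G,T) + I` is the signed cycle--cocycle matrix
    (∀ T : Set G.Edge, MapCritical.IsSpanningTree G.dirGraph.toGraph T →
      G.IsSpanningQuasiTree T ∧ G.dirGraph.cycleCocycleMatrix T = G.matrixA T + 1) ∧
    -- spanning trees exist, and the critical group of the map, computed from any spanning
    -- quasi-tree `T` (and any direction of the map), is isomorphic to the classical critical group
    -- of the underlying abstract graph, computed from any direction `H` of that graph and any
    -- spanning tree `T'`
    (∃ T : Set G.Edge, MapCritical.IsSpanningTree G.graph T) ∧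
    (∀ T : Set G.Edge, G.IsSpanningQuasiTree T →
      ∀ H : MapCritical.DirGraph G.Vertex G.Edge, H.toGraph = G.graph →
        ∀ T' : Set G.Edge, MapCritical.IsSpanningTree G.graph T' →
          Nonempty (MapCritical.Coker (G.matrixA T + 1) ≃+
            MapCritical.Coker (H.cycleCocycleMatrix T'))) := by
  refine ⟨fun T hT => ?_, MapCritical.CombMap.exists_isSpanningTree_graph hG.1,
    fun T hT H hH T' hT' => ?_⟩
  · rw [G.toGraph_dirGraph] at hT
    have hc := MapCritical.CombMap.isCyclic_of_isSpanningTree hT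
    exact ⟨MapCritical.CombMap.isSpanningQuasiTree_iff.2 hc,
      MapCritical.DirectedMap.cycleCocycleMatrix_eq hG hc⟩
  · have := Fintype.ofFinite G.Edge
    have hc := MapCritical.CombMap.isSpanningQuasiTree_iff.1 hT
    rw [← MapCritical.DirectedMap.cycleCocycleMatrix_eq hG hc]
    exact MapCritical.DirGraph.nonempty_coker_equiv (G.toGraph_dirGraph.trans hH.symm)
      (MapCritical.DirectedMap.isSpanningTree_of_isCyclic hG hc) (hH ▸ hT')
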